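/- All rings are commutative and unital. A \emph{bounded archimedean $\ell$-algebra} is an $\mathbb R$-algebra $A$ with a partial order that is a lattice, such that $a\le b$ implies $a+c\le b+c$; $0\le a,b$ implies $0\le ab$; $0\le a$ and $0\le\lambda\in\mathbb R$ imply $0\le\lambda a$; for each $a\in A$ there is $n\in\mathbb N$ with $a\le n\cdot 1$; and if $n\cdot a\le b$ for all $n\in\mathbb N$ then $a\le 0$. (The zero algebra is allowed.) It is \emph{uniformly complete} if it is complete in the norm $\|a\|=\inf\{\lambda\in\mathbb R : |a|\le\lambda\cdot 1\}$, where $|a|=a\vee(-a)$ (with $\|0\|=0$ in the zero algebra), and \emph{clean} if each element is the sum of an idempotent and a unit. A \emph{modal operator} on $A$ is a map $\Box:A\to A$ such that, for all $a,b\in A$ and $\lambda\in\mathbb R$ (identified with $\lambda\cdot 1$), writing $a^+=a\vee 0$: $\Box(a\wedge b)=\Box a\wedge\Box b$; $\Box\lambda=\lambda+(1-\lambda)\Box 0$; $\Box(a^+)=(\Box a)^+$; $\Box(a+\lambda)=\Box a+\Box\lambda-\Box 0$; and $\Box(\lambda a)=(\Box\lambda)(\Box a)$ if $\lambda\ge 0$.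 Put $\Diamond a=1-\Box(1-a)$. Let $\boldsymbol{\mathit{mba}\ell}$ be the category of bounded archimedean $\ell$-algebras with a modal operator and unital $\ell$-algebra homomorphisms preserving $\Box$; let $\boldsymbol{\mathit{muba}\ell}$ be its full subcategory of uniformly complete objects, and $\boldsymbol{\mathit{mcuba}\ell}$ the full subcategory of $\boldsymbol{\mathit{muba}\ell}$ of objects $(A,\Box)$ with $A$ clean. A \emph{compact Hausdorff frame} is a pair $(X,R)$ of a (possibly empty) compact Hausdorff space $X$ and a binary relation $R$ on $X$ that is continuous: $R[x]=\{y : xRy\}$ is closed for each $x\in X$, and $R^{-1}[U]=\{x : xRy \text{ for some } y\in U\}$ is closed (open) whenever $U\subseteq X$ is closed (open). Let $\mathsf{KHK}$ be the category of compact Hausdorff frames and continuous maps $f:(X,R)\to(Y,S)$ satisfying $f(R[x])=S[f(x)]$ for each $x\in X$, and $\mathsf{DF}$ its full subcategory of those $(X,R)$ with $X$ a Stone space (that is, zero-dimensional). Let $\mathsf{MA}$ be the category of modal algebras, that is, boolean algebras with a unary function $\Box$ preserving finite meets (including $1$), and boolean homomorphisms preserving $\Box$; here $\Diamond a=\neg\Box\neg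 a$. For $\mathsf X\in\{\mathsf D,\mathsf T,\mathsf{K4},\mathsf B,\mathsf{S4},\mathsf{S5}\}$ a superscript $\mathsf X$ denotes the full subcategory of objects satisfying the following conditions. In $\boldsymbol{\mathit{muba}\ell}$ and $\boldsymbol{\mathit{mcuba}\ell}$, for all $a$: $\Box 0=0$ for $\mathsf D$; $\Box a\le a$ for $\mathsf T$; $\Box a\le\Box(\Box a(1-\Box 0)+a\Box 0)$ for $\mathsf{K4}$; $\Diamond\Box a(1-\Box 0)\le a(1-\Box 0)$ for $\mathsf B$. In $\mathsf{MA}$, for all $a$: $\Box 0=0$ for $\mathsf D$; $\Box a\le a$ for $\mathsf T$; $\Box a\le\Box\Box a$ for $\mathsf{K4}$; $\Diamond\Box a\le a$ for $\mathsf B$. In $\mathsf{KHK}$ and $\mathsf{DF}$: $R$ is serial ($R[x]\neq\varnothing$ for all $x$) for $\mathsf D$, reflexive for $\mathsf T$, transitive for $\mathsf{K4}$, symmetric for $\mathsf B$. In all cases $\mathsf{S4}$ means $\mathsf T$ and $\mathsf{K4}$, and $\mathsf{S5}$ means $\mathsf{S4}$ and $\mathsf B$. \textbf{Theorem.} Let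 $\mathsf X\in\{\mathsf D,\mathsf T,\mathsf{K4},\mathsf B,\mathsf{S4},\mathsf{S5}\}$. (1) The category $\boldsymbol{\mathit{muba}\ell}^{\mathsf X}$ is dually equivalent to $\mathsf{KHK}^{\mathsf X}$. (2) The categories $\boldsymbol{\mathit{mcuba}\ell}^{\mathsf X}$ and $\mathsf{MA}^{\mathsf X}$ are both dually equivalent to $\mathsf{DF}^{\mathsf X}$, and hence are equivalent to each other. -/

import Mathlib

open CategoryTheory

universe u

/-! ### Bounded archimedean lattice-ordered algebras -/

/-- A commutative unital `ℝ`-algebra with a lattice order is a *bounded archimedean `ℓ`-algebra*. -/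
structure IsBoundedArchLAlg (A : Type u) [CommRing A] [Lattice A] [Algebra ℝ A] : Prop where
  add_le_add_right : ∀ a b c : A, a ≤ b → a + c ≤ b + c
  mul_nonneg : ∀ a b : A, 0 ≤ a → 0 ≤ b → 0 ≤ a * b
  smul_nonneg : ∀ (r : ℝ) (a : A), 0 ≤ r → 0 ≤ a → 0 ≤ r • a
  bounded : ∀ a : A, ∃ n : ℕ, a ≤ n • (1 : A)
  archimedean : ∀ a b : A, (∀ n : ℕ, n • a ≤ b) → a ≤ 0

/-- The norm `‖a‖ = inf {r ∈ ℝ | |a| ≤ r · 1}`, where `|a| = a ⊔ -a`. On the zero algebra the set is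
all of `ℝ`, and the value is `0`. -/
noncomputable def unifNorm {A : Type u} [CommRing A] [Lattice A] [Algebra ℝ A] (a : A) : ℝ :=
  sInf {r : ℝ | |a| ≤ algebraMap ℝ A r}

/-- Completeness of the norm: every Cauchy sequence converges. -/
def IsUniformlyComplete (A : Type u) [CommRing A] [Lattice A] [Algebra ℝ A] : Prop :=
  ∀ s : ℕ → A,
    (∀ ε : ℝ, 0 < ε → ∃ N : ℕ, ∀ m n : ℕ, N ≤ m → N ≤ n → unifNorm (s m - s n) < ε) →
    ∃ a : A, ∀ ε : ℝ, 0 < ε → ∃ N : ℕ, ∀ n : ℕ, N ≤ n → unifNorm (s n - a) < ε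

/-- A commutative ring is *clean* if each element is the sum of an idempotent and a unit. -/
def IsCleanRing (A : Type u) [CommRing A] : Prop :=
  ∀ a : A, ∃ e v : A, IsIdempotentElem e ∧ IsUnit v ∧ a = e + v

/-- Modal operators on a bounded archimedean `ℓ`-algebra; `r ∈ ℝ` is identified with `r · 1`, and
`a ⊔ 0` is the positive part of `a`. -/
structure IsModalOperator {A : Type u} [CommRing A] [Lattice A] [Algebra ℝ A]
    (box : A → A) : Prop where
  box_inf : ∀ a b : A, box (a ⊓ b) = box a ⊓ box b
  box_real : ∀ r : ℝ,
    box (algebraMap ℝ A r) = algebraMap ℝ A r + (1 - algebraMap ℝ A r) * box 0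
  box_posPart : ∀ a : A, box (a ⊔ 0) = box a ⊔ 0
  box_add_real : ∀ (a : A) (r : ℝ),
    box (a + algebraMap ℝ A r) = box a + box (algebraMap ℝ A r) - box 0
  box_smul : ∀ (r : ℝ) (a : A), 0 ≤ r → box (r • a) = box (algebraMap ℝ A r) * box a

/-- Modal bounded archimedean `ℓ`-algebras. -/
structure MBal : Type (u + 1) where
  carrier : Type u
  [commRing : CommRing carrier]
  [lattice : Lattice carrier]
  [algebra : Algebra ℝ carrier]
  isBal : IsBoundedArchLAlg carrier
  box : carrier → carrier
  isModalOperator : IsModalOperator box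

namespace MBal

attribute [instance] MBal.commRing MBal.lattice MBal.algebra

/-- Unital `ℓ`-algebra homomorphisms preserving `□`. -/
@[ext]
structure Hom (A B : MBal.{u}) extends A.carrier →ₐ[ℝ] B.carrier where
  map_inf' : ∀ a b : A.carrier, toFun (a ⊓ b) = toFun a ⊓ toFun b
  map_sup' : ∀ a b : A.carrier, toFun (a ⊔ b) = toFun a ⊔ toFun b
  map_box' : ∀ a : A.carrier, toFun (A.box a) = B.box (toFun a)

instance : Category.{u} MBal.{u} where
  Hom A B := Hom A B
  id A :=
    { AlgHom.id ℝ A.carrier with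
      map_inf' := fun _ _ => rfl
      map_sup' := fun _ _ => rfl
      map_box' := fun _ => rfl }
  comp {A B C} f g :=
    { g.toAlgHom.comp f.toAlgHom with
      map_inf' := fun a b => (congrArg g.toFun (f.map_inf' a b)).trans (g.map_inf' _ _)
      map_sup' := fun a b => (congrArg g.toFun (f.map_sup' a b)).trans (g.map_sup' _ _)
      map_box' := fun a => (congrArg g.toFun (f.map_box' a)).trans (g.map_box' _) }

/-- `◇a = 1 - □(1 - a)`. -/
def dia (A : MBal.{u}) (a : A.carrier) : A.carrier := 1 - A.box (1 - a)

/-- `□0 = 0`. -/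
def SatD (A : MBal.{u}) : Prop := A.box 0 = 0

/-- `□a ≤ a`. -/
def SatT (A : MBal.{u}) : Prop := ∀ a : A.carrier, A.box a ≤ a

/-- `□a ≤ □(□a(1 - □0) + a□0)`. -/
def SatK4 (A : MBal.{u}) : Prop :=
  ∀ a : A.carrier, A.box a ≤ A.box (A.box a * (1 - A.box 0) + a * A.box 0)

/-- `◇□a(1 - □0) ≤ a(1 - □0)`. -/
def SatB (A : MBal.{u}) : Prop :=
  ∀ a : A.carrier, A.dia (A.box a) * (1 - A.box 0) ≤ a * (1 - A.box 0)

end MBal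

/-! ### Compact Hausdorff frames -/

/-- Continuous relations on a topological space. Here `{y | R x y}` is `R[x]` and
`{x | ∃ y ∈ U, R x y}` is `R⁻¹[U]`. -/
structure IsContinuousRel {X : Type u} [TopologicalSpace X] (R : X → X → Prop) : Prop where
  isClosed_image : ∀ x : X, IsClosed {y | R x y}
  isClosed_preimage : ∀ F : Set X, IsClosed F → IsClosed {x | ∃ y ∈ F, R x y}
  isOpen_preimage : ∀ U : Set X, IsOpen U → IsOpen {x | ∃ y ∈ U, R x y}

/-- Compact Hausdorff frames. -/
structure KHFrame : Type (u + 1) where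
  carrier : Type u
  [topologicalSpace : TopologicalSpace carrier]
  [compactSpace : CompactSpace carrier]
  [t2Space : T2Space carrier]
  rel : carrier → carrier → Prop
  isContinuousRel : IsContinuousRel rel

namespace KHFrame

attribute [instance] KHFrame.topologicalSpace KHFrame.compactSpace KHFrame.t2Space

/-- Continuous bounded morphisms: `f(R[x]) = S[f(x)]`. -/
@[ext]
structure Hom (F G : KHFrame.{u}) extends C(F.carrier, G.carrier) where
  image_rel' : ∀ x : F.carrier, toFun '' {y | F.rel x y} = {z | G.rel (toFun x) z}

instance : Category.{u} KHFrame.{u} where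
  Hom F G := Hom F G
  id F :=
    { ContinuousMap.id F.carrier with
      image_rel' := fun _ => Set.image_id _ }
  comp {F G H} f g :=
    { g.toContinuousMap.comp f.toContinuousMap with
      image_rel' := fun x =>
        (Set.image_comp g.toFun f.toFun _).trans
          ((congrArg (Set.image g.toFun) (f.image_rel' x)).trans (g.image_rel' _)) }

/-- The underlying compact Hausdorff space is zero-dimensional, that is, a Stone space. -/
def IsStone (F : KHFrame.{u}) : Prop :=
  TopologicalSpace.IsTopologicalBasis {U : Set F.carrier | IsClopen U}

/-- The relation is serial. -/
def SatD (F : KHFrame.{u}) : Prop := ∀ x : F.carrier, ∃ y, F.rel x y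

/-- The relation is reflexive. -/
def SatT (F : KHFrame.{u}) : Prop := ∀ x : F.carrier, F.rel x x

/-- The relation is transitive. -/
def SatK4 (F : KHFrame.{u}) : Prop :=
  ∀ x y z : F.carrier, F.rel x y → F.rel y z → F.rel x z

/-- The relation is symmetric. -/
def SatB (F : KHFrame.{u}) : Prop := ∀ x y : F.carrier, F.rel x y → F.rel y x

end KHFrame

/-! ### Modal algebras -/

/-- Modal algebras. -/
structure ModalAlg : Type (u + 1) where
  carrier : Type u
  [booleanAlgebra : BooleanAlgebra carrier]
  box : carrier → carrier
  box_inf : ∀ a b : carrier, box (a ⊓ b) = box a ⊓ box b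
  box_top : box ⊤ = ⊤

namespace ModalAlg

attribute [instance] ModalAlg.booleanAlgebra

/-- Boolean homomorphisms preserving `□`. -/
@[ext]
structure Hom (A B : ModalAlg.{u}) extends BoundedLatticeHom A.carrier B.carrier where
  map_box' : ∀ a : A.carrier, toFun (A.box a) = B.box (toFun a)

instance : Category.{u} ModalAlg.{u} where
  Hom A B := Hom A B
  id A :=
    { BoundedLatticeHom.id A.carrier with
      map_box' := fun _ => rfl }
  comp {A B C} f g :=
    { g.toBoundedLatticeHom.comp f.toBoundedLatticeHom with
      map_box' := fun a => (congrArg g.toFun (f.map_box' a)).trans (g.map_box' _) }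

/-- `◇a = ¬□¬a`. -/
def dia (A : ModalAlg.{u}) (a : A.carrier) : A.carrier := (A.box aᶜ)ᶜ

/-- `□⊥ = ⊥` (equivalently `◇⊤ = ⊤`). -/
def SatD (A : ModalAlg.{u}) : Prop := A.box ⊥ = ⊥

/-- `□a ≤ a`. -/
def SatT (A : ModalAlg.{u}) : Prop := ∀ a : A.carrier, A.box a ≤ a

/-- `□a ≤ □□a`. -/
def SatK4 (A : ModalAlg.{u}) : Prop := ∀ a : A.carrier, A.box a ≤ A.box (A.box a)

/-- `◇□a ≤ a`. -/
def SatB (A : ModalAlg.{u}) : Prop := ∀ a : A.carrier, A.dia (A.box a) ≤ a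

end ModalAlg

/-! ### The categories attached to the six logics -/

/-- The modal logics `D`, `T`, `K4`, `B`, `S4`, `S5`. -/
inductive ModalLogic : Type
  | D | T | K4 | B | S4 | S5

/-- Modal bounded archimedean `ℓ`-algebras satisfying the axioms of the logic `L`. -/
def MBal.Sat (L : ModalLogic) : ObjectProperty MBal.{u} := fun A =>
  match L with
  | .D => A.SatD
  | .T => A.SatT
  | .K4 => A.SatK4
  | .B => A.SatB
  | .S4 => A.SatT ∧ A.SatK4
  | .S5 => (A.SatT ∧ A.SatK4) ∧ A.SatB

/-- Compact Hausdorff frames whose relation has the properties corresponding to `L`. -/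
def KHFrame.Sat (L : ModalLogic) : ObjectProperty KHFrame.{u} := fun F =>
  match L with
  | .D => F.SatD
  | .T => F.SatT
  | .K4 => F.SatK4
  | .B => F.SatB
  | .S4 => F.SatT ∧ F.SatK4
  | .S5 => (F.SatT ∧ F.SatK4) ∧ F.SatB

/-- Modal algebras satisfying the axioms of `L`. -/
def ModalAlg.Sat (L : ModalLogic) : ObjectProperty ModalAlg.{u} := fun A =>
  match L with
  | .D => A.SatD
  | .T => A.SatT
  | .K4 => A.SatK4
  | .B => A.SatB
  | .S4 => A.SatT ∧ A.SatK4
  | .S5 => (A.SatT ∧ A.SatK4) ∧ A.SatB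

/-- The full subcategory of uniformly complete modal bounded archimedean `ℓ`-algebras
satisfying `L`. -/
abbrev MubalCat (L : ModalLogic) : Type (u + 1) :=
  ObjectProperty.FullSubcategory
    (fun A : MBal.{u} => IsUniformlyComplete A.carrier ∧ MBal.Sat L A)

/-- The full subcategory of clean uniformly complete modal bounded archimedean `ℓ`-algebras
satisfying `L`. -/
abbrev McubalCat (L : ModalLogic) : Type (u + 1) :=
  ObjectProperty.FullSubcategory
    (fun A : MBal.{u} =>
      (IsUniformlyComplete A.carrier ∧ IsCleanRing A.carrier) ∧ MBal.Sat L A)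

/-- The full subcategory of modal algebras satisfying `L`. -/
abbrev MACat (L : ModalLogic) : Type (u + 1) :=
  ObjectProperty.FullSubcategory (fun A : ModalAlg.{u} => ModalAlg.Sat L A)

/-- The full subcategory of compact Hausdorff frames satisfying `L`. -/
abbrev KHFCat (L : ModalLogic) : Type (u + 1) :=
  ObjectProperty.FullSubcategory (fun F : KHFrame.{u} => KHFrame.Sat L F)

/-- The full subcategory of descriptive frames satisfying `L`. -/
abbrev DFCat (L : ModalLogic) : Type (u + 1) :=
  ObjectProperty.FullSubcategory (fun F : KHFrame.{u} => F.IsStone ∧ KHFrame.Sat L F)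

/-! ### Dual equivalences between full subcategories -/

/-! A frame `F` is sent to `C(F, ℝ)`, where `□f` at `x` is the minimum of `f` on `R[x]`. At a point
without successors the value is 1. This is forced: the scaling axiom with `λ = 0` gives `□0 = □0 ·
□a`, so `□0` is idempotent and every `□a` equals 1 where `□0` does.

The functor is fully faithful. By Gelfand duality an algebra map between such rings is composition
with a continuous map, and since each `R[x]` is closed, Urysohn functions show that preserving `□`
makes this map a bounded morphism. For essential surjectivity, the points are the positive
characters of `A`. The archimedean axiom provides enough of them, through maximal positive cones
(`IsBoundedArchLAlg.exists_pos_algHom`), so evaluation is an order embedding. Stone-Weierstrass and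
uniform completeness make it onto (`PosSpectrum.eval_surjective`). The relation is `x(□a) ≤ y(a)`
for all `a`, and the crux is that the minimum is attained: if `x(□0) = 0`, some successor `y` has
`y(a) = x(□a)` (`MBal.exists_specRel_eval_eq`).

Each axiom on `C(F, ℝ)` corresponds to its condition on `R`, and axioms pass along surjective
homomorphisms. Cleanness of `C(X, ℝ)` amounts to zero-dimensionality of `X`, so the first duality
restricts to the clean case. On the boolean side the argument has the same shape, with clopen sets
for functions and the prime ideal theorem for maximal cones. -/

section DualEquivalence

universe v₁ v₂ u₁ u₂

variable {C : Type u₁} [Category.{v₁} C] {D : Type u₂} [Category.{v₂} D]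

/-- The restriction of a contravariant functor to full subcategories. -/
def restrictOp (F : C ⥤ Dᵒᵖ) (P : ObjectProperty C) (Q : ObjectProperty D)
    (h : ∀ c, P c → Q (F.obj c).unop) : P.FullSubcategory ⥤ Q.FullSubcategoryᵒᵖ where
  obj c := Opposite.op ⟨(F.obj c.obj).unop, h _ c.property⟩
  map f := (ObjectProperty.homMk (F.map f.hom).unop).op
  map_id c := by
    apply Quiver.Hom.unop_inj
    ext
    simp
  map_comp f g := by
    apply Quiver.Hom.unop_inj
    ext
    simp

/-- All three dualities are instances. Fullness and faithfulness are required only between objects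
satisfying `P`, because the clopen functor is handled only on Stone frames. -/
theorem nonempty_dualEquivalence (F : C ⥤ Dᵒᵖ) (P : ObjectProperty C) (Q : ObjectProperty D)
    (h : ∀ c, P c → Q (F.obj c).unop)
    (faithful : ∀ c c', P c → P c' → Function.Injective (F.map : (c ⟶ c') → _))
    (full : ∀ c c', P c → P c' → Function.Surjective (F.map : (c ⟶ c') → _))
    (ess : ∀ d, Q d → ∃ c, P c ∧ Nonempty ((F.obj c).unop ≅ d)) :
    Nonempty (Q.FullSubcategoryᵒᵖ ≌ P.FullSubcategory) := by
  let G := restrictOp F P Q h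
  have : G.Faithful := ⟨fun {c c'} f g hfg => by
    have h1 : (F.map f.hom).unop = (F.map g.hom).unop :=
      congrArg (fun t : G.obj c ⟶ G.obj c' => t.unop.hom) hfg
    ext
    exact faithful _ _ c.property c'.property (Quiver.Hom.unop_inj h1)⟩
  have : G.Full := ⟨fun {c c'} f => by
    obtain ⟨g, hg⟩ := full _ _ c.property c'.property f.unop.hom.op
    refine ⟨ObjectProperty.homMk g, ?_⟩
    apply Quiver.Hom.unop_inj
    ext
    exact congrArg Quiver.Hom.unop hg⟩
  have : G.EssSurj := ⟨fun d => by
    obtain ⟨c, hc, ⟨e⟩⟩ := ess d.unop.obj d.unop.property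
    exact ⟨⟨c, hc⟩, ⟨(ObjectProperty.isoMk Q (X := d.unop) (Y := (G.obj ⟨c, hc⟩).unop) e.symm).op⟩⟩⟩
  have : G.IsEquivalence := {}
  exact ⟨G.asEquivalence.symm⟩

end DualEquivalence

/-! ### The modal operator of a compact Hausdorff frame -/

namespace KHFrame

section Box

variable (F : KHFrame.{u})

open Classical in
/-- The value at `x` of `□f`: the minimum of `f` on `R[x]`, and `1` if `R[x]` is empty. -/
noncomputable def boxFun (f : C(F.carrier, ℝ)) (x : F.carrier) : ℝ :=
  if ∃ y, F.rel x y then sInf (f '' {y | F.rel x y}) else 1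

variable {F}

theorem boxFun_of_not_exists {f : C(F.carrier, ℝ)} {x : F.carrier} (h : ¬ ∃ y, F.rel x y) :
    F.boxFun f x = 1 := if_neg h

theorem exists_boxFun_eq (f : C(F.carrier, ℝ)) {x : F.carrier} (h : ∃ y, F.rel x y) :
    ∃ y, F.rel x y ∧ F.boxFun f x = f y ∧ ∀ z, F.rel x z → f y ≤ f z := by
  have hc : IsCompact {y | F.rel x y} := (F.isContinuousRel.isClosed_image x).isCompact
  obtain ⟨y, hy, hy'⟩ := hc.exists_isMinOn h f.continuous.continuousOn
  refine ⟨y, hy, ?_, fun z hz => hy' hz⟩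
  rw [boxFun, if_pos h]
  exact IsLeast.csInf_eq ⟨⟨y, hy, rfl⟩, by rintro _ ⟨z, hz, rfl⟩; exact hy' hz⟩

theorem boxFun_le (f : C(F.carrier, ℝ)) {x y : F.carrier} (h : F.rel x y) :
    F.boxFun f x ≤ f y := by
  obtain ⟨z, -, hz, hz'⟩ := exists_boxFun_eq f ⟨y, h⟩
  exact hz.trans_le (hz' y h)

theorem le_boxFun {f : C(F.carrier, ℝ)} {x : F.carrier} {c : ℝ} (h : ∃ y, F.rel x y)
    (hc : ∀ y, F.rel x y → c ≤ f y) : c ≤ F.boxFun f x := by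
  obtain ⟨z, hxz, hz, -⟩ := exists_boxFun_eq f h
  exact (hc z hxz).trans_eq hz.symm

theorem boxFun_eq_of_isMin {f : C(F.carrier, ℝ)} {x y : F.carrier} (h : F.rel x y)
    (hy : ∀ z, F.rel x z → f y ≤ f z) : F.boxFun f x = f y :=
  le_antisymm (boxFun_le f h) (le_boxFun ⟨y, h⟩ hy)

theorem boxFun_algebraMap (r : ℝ) {x : F.carrier} (h : ∃ y, F.rel x y) :
    F.boxFun (algebraMap ℝ C(F.carrier, ℝ) r) x = r := by
  obtain ⟨y, hy⟩ := h
  exact boxFun_eq_of_isMin hy fun _ _ => le_rfl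

theorem boxFun_zero {x : F.carrier} (h : ∃ y, F.rel x y) : F.boxFun 0 x = 0 := by
  obtain ⟨y, hy⟩ := h
  exact boxFun_eq_of_isMin hy fun _ _ => le_rfl

theorem boxFun_eq_one {f : C(F.carrier, ℝ)} {x : F.carrier} (h : ∀ y, F.rel x y → f y = 1) :
    F.boxFun f x = 1 := by
  by_cases hx : ∃ y, F.rel x y
  · obtain ⟨y, hy, e, -⟩ := exists_boxFun_eq f hx
    rw [e, h y hy]
  · exact boxFun_of_not_exists hx

theorem isClosed_exists_rel : IsClosed {x | ∃ y, F.rel x y} := by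
  simpa using F.isContinuousRel.isClosed_preimage _ isClosed_univ

theorem isOpen_exists_rel : IsOpen {x | ∃ y, F.rel x y} := by
  simpa using F.isContinuousRel.isOpen_preimage _ isOpen_univ

/-- Since minima are attained, a sublevel set of `□f` is `R⁻¹` of the corresponding sublevel set of
`f`, up to the clopen set of points without successors. Closed preimages give lower semicontinuity,
open preimages give upper semicontinuity. -/
theorem continuous_boxFun (f : C(F.carrier, ℝ)) : Continuous (F.boxFun f) := by
  rw [continuous_iff_lower_upperSemicontinuous, lowerSemicontinuous_iff_isClosed_preimage,
    upperSemicontinuous_iff_isOpen_preimage]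
  have hO : IsOpen {x | ¬ ∃ y, F.rel x y} := isClosed_exists_rel.isOpen_compl
  have hC : IsClosed {x | ¬ ∃ y, F.rel x y} := isOpen_exists_rel.isClosed_compl
  constructor
  · intro r
    have : F.boxFun f ⁻¹' Set.Iic r =
        {x | ∃ y ∈ f ⁻¹' Set.Iic r, F.rel x y} ∪ ({x | ¬ ∃ y, F.rel x y} ∩ {_x | 1 ≤ r}) := by
      ext x
      by_cases hx : ∃ y, F.rel x y
      · obtain ⟨y, hy, e, hm⟩ := exists_boxFun_eq f hx
        simp only [Set.mem_preimage, Set.mem_Iic, Set.mem_union, Set.mem_ofPred_eq, e,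
          Set.mem_inter_iff, hx, not_true, false_and, or_false]
        exact ⟨fun h => ⟨y, h, hy⟩, fun ⟨z, hz, hxz⟩ => (hm z hxz).trans hz⟩
      · simp only [Set.mem_preimage, Set.mem_Iic, Set.mem_union, Set.mem_ofPred_eq,
          boxFun_of_not_exists hx, Set.mem_inter_iff, hx, not_false_iff, true_and]
        exact ⟨Or.inr, fun h => h.resolve_left fun ⟨z, _, hz⟩ => hx ⟨z, hz⟩⟩
    rw [this]
    exact (F.isContinuousRel.isClosed_preimage _ (isClosed_Iic.preimage f.continuous)).union
      (hC.inter isClosed_const)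
  · intro r
    have : F.boxFun f ⁻¹' Set.Iio r =
        {x | ∃ y ∈ f ⁻¹' Set.Iio r, F.rel x y} ∪ ({x | ¬ ∃ y, F.rel x y} ∩ {_x | 1 < r}) := by
      ext x
      by_cases hx : ∃ y, F.rel x y
      · obtain ⟨y, hy, e, hm⟩ := exists_boxFun_eq f hx
        simp only [Set.mem_preimage, Set.mem_Iio, Set.mem_union, Set.mem_ofPred_eq, e,
          Set.mem_inter_iff, hx, not_true, false_and, or_false]
        exact ⟨fun h => ⟨y, h, hy⟩, fun ⟨z, hz, hxz⟩ => (hm z hxz).trans_lt hz⟩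
      · simp only [Set.mem_preimage, Set.mem_Iio, Set.mem_union, Set.mem_ofPred_eq,
          boxFun_of_not_exists hx, Set.mem_inter_iff, hx, not_false_iff, true_and]
        exact ⟨Or.inr, fun h => h.resolve_left fun ⟨z, _, hz⟩ => hx ⟨z, hz⟩⟩
    rw [this]
    exact (F.isContinuousRel.isOpen_preimage _ (isOpen_Iio.preimage f.continuous)).union
      (hO.inter isOpen_const)

variable (F) in
/-- The operator `□` on `C(F, ℝ)`. -/
noncomputable def box (f : C(F.carrier, ℝ)) : C(F.carrier, ℝ) := ⟨F.boxFun f, continuous_boxFun f⟩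

@[simp] theorem box_apply (f : C(F.carrier, ℝ)) (x : F.carrier) : F.box f x = F.boxFun f x := rfl

theorem isModalOperator_box : IsModalOperator F.box where
  box_inf a b := by
    ext x
    by_cases hx : ∃ y, F.rel x y
    · obtain ⟨y, hy, e, hm⟩ := exists_boxFun_eq a hx
      obtain ⟨z, hz, e', hm'⟩ := exists_boxFun_eq b hx
      simp only [box_apply, ContinuousMap.inf_apply]
      apply le_antisymm
      · exact le_inf (e ▸ (boxFun_le (a ⊓ b) hy).trans inf_le_left)
          (e' ▸ (boxFun_le (a ⊓ b) hz).trans inf_le_right)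
      · exact le_boxFun hx fun w hw => inf_le_inf (boxFun_le a hw) (boxFun_le b hw)
    · simp [boxFun_of_not_exists hx]
  box_real r := by
    ext x
    by_cases hx : ∃ y, F.rel x y
    · simp [boxFun_algebraMap r hx, boxFun_zero hx]
    · simp [boxFun_of_not_exists hx]
  box_posPart a := by
    ext x
    by_cases hx : ∃ y, F.rel x y
    · obtain ⟨y, hy, e, hm⟩ := exists_boxFun_eq a hx
      simp only [box_apply, ContinuousMap.sup_apply, e]
      exact boxFun_eq_of_isMin hy fun z hz => sup_le_sup_right (hm z hz) _
    · simp [boxFun_of_not_exists hx]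
  box_add_real a r := by
    ext x
    by_cases hx : ∃ y, F.rel x y
    · obtain ⟨y, hy, e, hm⟩ := exists_boxFun_eq a hx
      simp only [box_apply, ContinuousMap.sub_apply, ContinuousMap.add_apply, e,
        boxFun_algebraMap r hx, boxFun_zero hx, sub_zero]
      exact boxFun_eq_of_isMin hy fun z hz => add_le_add_left (hm z hz) _
    · simp [boxFun_of_not_exists hx]
  box_smul r a hr := by
    ext x
    by_cases hx : ∃ y, F.rel x y
    · obtain ⟨y, hy, e, hm⟩ := exists_boxFun_eq a hx
      simp only [box_apply, ContinuousMap.mul_apply, e, boxFun_algebraMap r hx]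
      exact boxFun_eq_of_isMin hy fun z hz => mul_le_mul_of_nonneg_left (hm z hz) hr
    · simp [boxFun_of_not_exists hx]

end Box

/-! ### The contravariant functor of real continuous functions -/

theorem isBoundedArchLAlg_continuousMap (X : Type u) [TopologicalSpace X] [CompactSpace X] :
    IsBoundedArchLAlg C(X, ℝ) where
  add_le_add_right a b c h x := add_le_add_left (h x) _
  mul_nonneg a b ha hb x := mul_nonneg (ha x) (hb x)
  smul_nonneg r a hr ha x := mul_nonneg hr (ha x)
  bounded a := by
    obtain ⟨n, hn⟩ := exists_nat_ge ‖a‖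
    refine ⟨n, fun x => ?_⟩
    simpa using ((le_abs_self _).trans (a.norm_coe_le_norm x)).trans hn
  archimedean a b h x := by
    by_contra! hx
    obtain ⟨n, hn⟩ := Archimedean.arch (b x + 1) hx
    have h1 : n • a x ≤ b x := h n x
    have h2 : b x + 1 ≤ n • a x := hn
    linarith

/-- The modal algebra of real continuous functions of a compact Hausdorff frame. -/
noncomputable def toMBal (F : KHFrame.{u}) : MBal.{u} where
  carrier := C(F.carrier, ℝ)
  isBal := isBoundedArchLAlg_continuousMap _
  box := F.box
  isModalOperator := isModalOperator_box

theorem Hom.rel_map {F G : KHFrame.{u}} (f : Hom F G) {x y : F.carrier} (h : F.rel x y) :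
    G.rel (f.toFun x) (f.toFun y) :=
  (Set.ext_iff.1 (f.image_rel' x) (f.toFun y)).1 ⟨y, h, rfl⟩

theorem Hom.exists_rel {F G : KHFrame.{u}} (f : Hom F G) {x : F.carrier} {z : G.carrier}
    (h : G.rel (f.toFun x) z) : ∃ y, F.rel x y ∧ f.toFun y = z :=
  (Set.ext_iff.1 (f.image_rel' x) z).2 h

/-- Composition with a morphism of frames. -/
noncomputable def Hom.toMBalHom {F G : KHFrame.{u}} (f : Hom F G) : MBal.Hom G.toMBal F.toMBal where
  toAlgHom := ContinuousMap.compRightAlgHom ℝ ℝ f.toContinuousMap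
  map_inf' _ _ := rfl
  map_sup' _ _ := rfl
  map_box' (a : C(G.carrier, ℝ)) := by
    refine ContinuousMap.ext fun x => ?_
    change G.boxFun a (f.toFun x) = F.boxFun (a.comp f.toContinuousMap) x
    by_cases hx : ∃ y, F.rel x y
    · obtain ⟨y, hy, e, hm⟩ := exists_boxFun_eq (a.comp f.toContinuousMap) hx
      rw [e]
      refine boxFun_eq_of_isMin (f.rel_map hy) fun z hz => ?_
      obtain ⟨w, hw, rfl⟩ := f.exists_rel hz
      exact hm w hw
    · refine (boxFun_of_not_exists ?_).trans (boxFun_of_not_exists hx).symm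
      rintro ⟨z, hz⟩
      obtain ⟨w, hw, -⟩ := f.exists_rel hz
      exact hx ⟨w, hw⟩

/-- The contravariant functor of real continuous functions. -/
noncomputable def toMBalFunctor : KHFrame.{u} ⥤ MBal.{u}ᵒᵖ where
  obj F := Opposite.op F.toMBal
  map f := Quiver.Hom.op (Hom.toMBalHom f)
  map_id _ := rfl
  map_comp _ _ := rfl

/-- The main use is with `K = R[x]`: then `□f` is 1 at `x`, even if `R[x]` is empty, while `f`
vanishes at a prescribed point outside `R[x]`. -/
theorem exists_continuous_zero_one {X : Type u} [TopologicalSpace X] [CompactSpace X] [T2Space X]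
    {x : X} {K : Set X} (hK : IsClosed K) (hx : x ∉ K) :
    ∃ f : C(X, ℝ), f x = 0 ∧ ∀ y ∈ K, f y = 1 := by
  obtain ⟨f, hf0, hf1, -⟩ := exists_continuous_zero_one_of_isClosed (isClosed_singleton (x := x)) hK
    (Set.disjoint_singleton_left.2 hx)
  exact ⟨f, hf0 rfl, fun y hy => hf1 hy⟩

/-- Evaluation at `x` after `φ` is a character of `C(Y, ℝ)`, hence evaluation at a point of the
compact Hausdorff space `Y`. -/
theorem exists_continuousMap_of_algHom {X Y : Type u} [TopologicalSpace X]
    [TopologicalSpace Y] [CompactSpace Y] [T2Space Y] (φ : C(Y, ℝ) →ₐ[ℝ] C(X, ℝ)) :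
    ∃ g : C(X, Y), ∀ f, φ f = f.comp g := by
  let c : X → WeakDual.characterSpace ℝ C(Y, ℝ) := fun x =>
    WeakDual.CharacterSpace.equivAlgHom.symm ((ContinuousMap.evalAlgHom ℝ ℝ x).comp φ)
  have hc : Continuous c := by
    refine Continuous.subtype_mk (WeakDual.continuous_of_continuous_eval fun f => ?_) _
    exact (φ f).continuous
  refine ⟨⟨_, (WeakDual.CharacterSpace.homeoEval Y ℝ).symm.continuous.comp hc⟩, fun f => ?_⟩
  ext x
  have h := (WeakDual.CharacterSpace.homeoEval Y ℝ).apply_symm_apply (c x)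
  exact (congrArg (fun t : WeakDual.characterSpace ℝ C(Y, ℝ) => t f) h).symm

theorem toMBalFunctor_map_injective (F G : KHFrame.{u}) :
    Function.Injective (toMBalFunctor.map : (F ⟶ G) → _) := by
  intro f g h
  have h' : Hom.toMBalHom f = Hom.toMBalHom g :=
    congrArg (fun t : Opposite.op F.toMBal ⟶ Opposite.op G.toMBal => t.unop) h
  apply Hom.ext
  funext x
  by_contra hne
  obtain ⟨a, ha, ha'⟩ := exists_continuous_zero_one (x := f.toFun x) (K := {g.toFun x})
    isClosed_singleton hne
  have h0 : a (f.toFun x) = a (g.toFun x) :=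
    congrArg (fun t : MBal.Hom G.toMBal F.toMBal => DFunLike.coe (F := C(F.carrier, ℝ)) (t.toFun a) x) h'
  rw [ha, ha' _ rfl] at h0
  exact zero_ne_one h0

theorem toMBalFunctor_map_surjective (F G : KHFrame.{u}) :
    Function.Surjective (toMBalFunctor.map : (F ⟶ G) → _) := by
  intro φ'
  obtain ⟨φ, rfl⟩ : ∃ φ : G.toMBal ⟶ F.toMBal, φ' = φ.op := ⟨φ'.unop, rfl⟩
  obtain ⟨g, hg⟩ := exists_continuousMap_of_algHom (X := F.carrier) (Y := G.carrier) φ.toAlgHom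
  have hbox (a : C(G.carrier, ℝ)) (x : F.carrier) :
      G.boxFun a (g x) = F.boxFun (a.comp g) x := by
    have h1 := φ.map_box' a
    have h2 : φ.toFun (G.box a) = (G.box a).comp g := hg _
    have h3 : φ.toFun a = a.comp g := hg _
    have h4 : (G.box a).comp g = F.box (a.comp g) := h2.symm.trans (h1.trans (congrArg F.box h3))
    exact congrArg (fun t : C(F.carrier, ℝ) => t x) h4
  refine ⟨(⟨g, fun x => Set.Subset.antisymm ?_ ?_⟩ : Hom F G), ?_⟩
  · rintro _ ⟨y, hy, rfl⟩
    by_contra hn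
    obtain ⟨a, ha, ha'⟩ := exists_continuous_zero_one (x := g y)
      (G.isContinuousRel.isClosed_image (g x)) hn
    have h1 : G.boxFun a (g x) = 1 := boxFun_eq_one ha'
    have h2 : F.boxFun (a.comp g) x ≤ a (g y) := boxFun_le (a.comp g) hy
    rw [← hbox, h1, ha] at h2
    exact absurd h2 (by norm_num)
  · intro z hz
    by_contra hn
    obtain ⟨a, ha, ha'⟩ := exists_continuous_zero_one (x := z)
      (((F.isContinuousRel.isClosed_image x).isCompact.image g.continuous).isClosed) hn
    have h1 : F.boxFun (a.comp g) x = 1 := boxFun_eq_one fun y hy => ha' _ ⟨y, hy, rfl⟩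
    have h2 : G.boxFun a (g x) ≤ a z := boxFun_le a hz
    rw [hbox, h1, ha] at h2
    exact absurd h2 (by norm_num)
  · refine congrArg (Quiver.Hom.op (X := G.toMBal) (Y := F.toMBal)) ?_
    apply MBal.Hom.ext
    funext a
    exact (hg a).symm

end KHFrame

/-! ### Properties of the algebra of continuous functions -/

theorem unifNorm_continuousMap {X : Type u} [TopologicalSpace X] [CompactSpace X]
    (f : C(X, ℝ)) : unifNorm f = ‖f‖ := by
  have hset : {r : ℝ | |f| ≤ algebraMap ℝ C(X, ℝ) r} = {r : ℝ | ∀ x, ‖f x‖ ≤ r} := by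
    ext r
    exact Iff.rfl
  rw [unifNorm, hset]
  -- On the empty space every real is a bound, and `sInf` of all of `ℝ` is 0 by convention, in
  -- agreement with the norm.
  rcases isEmpty_or_nonempty X with hX | hX
  · have : {r : ℝ | ∀ x, ‖f x‖ ≤ r} = Set.univ := by
      ext r
      simp
    rw [this, Real.sInf_univ]
    exact (norm_eq_zero.2 (Subsingleton.elim f 0)).symm
  · exact IsLeast.csInf_eq
      ⟨f.norm_coe_le_norm, fun r hr => (ContinuousMap.norm_le_of_nonempty f).2 hr⟩

theorem isUniformlyComplete_continuousMap (X : Type u) [TopologicalSpace X] [CompactSpace X] :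
    IsUniformlyComplete C(X, ℝ) := by
  intro s hs
  have hc : CauchySeq s := by
    rw [Metric.cauchySeq_iff]
    intro ε hε
    obtain ⟨N, hN⟩ := hs ε hε
    refine ⟨N, fun m hm n hn => ?_⟩
    rw [dist_eq_norm, ← unifNorm_continuousMap]
    exact hN m n hm hn
  obtain ⟨a, ha⟩ := cauchySeq_tendsto_of_complete hc
  refine ⟨a, fun ε hε => ?_⟩
  obtain ⟨N, hN⟩ := Metric.tendsto_atTop.1 ha ε hε
  refine ⟨N, fun n hn => ?_⟩
  rw [unifNorm_continuousMap, ← dist_eq_norm]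
  exact hN n hn

/-- Take `f = e + v` vanishing at `x` and equal to 1 off `U`. A unit has no zeros, so `e` is 1 at
`x` and differs from 1 off `U`; thus `{e = 1}` is a clopen neighbourhood of `x` inside `U`.
Conversely, a clopen `V` containing `{f = 0}` and disjoint from `{f = 1}` makes `f - 1_V` nowhere
zero. -/
theorem isCleanRing_continuousMap_iff (X : Type u) [TopologicalSpace X] [CompactSpace X]
    [T2Space X] :
    IsCleanRing C(X, ℝ) ↔ TopologicalSpace.IsTopologicalBasis {U : Set X | IsClopen U} := by
  constructor
  · intro h
    refine TopologicalSpace.isTopologicalBasis_of_isOpen_of_nhds (fun U hU => hU.isOpen) ?_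
    intro x U hx hU
    obtain ⟨f, hf0, hf1⟩ := KHFrame.exists_continuous_zero_one hU.isClosed_compl
      (fun hn => hn hx : x ∉ Uᶜ)
    obtain ⟨e, v, he, hv, rfl⟩ := h f
    have he' (y : X) : e y = 0 ∨ e y = 1 := by
      have := congrArg (fun t : C(X, ℝ) => t y) he
      have h2 : e y * (e y - 1) = 0 := by
        have : e y * e y = e y := this
        linarith
      rcases mul_eq_zero.1 h2 with h3 | h3
      · exact Or.inl h3
      · exact Or.inr (by linarith)
    have hv' (y : X) : v y ≠ 0 := by
      obtain ⟨w, hw⟩ := hv.exists_right_inv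
      intro h0
      have : v y * w y = 1 := congrArg (fun t : C(X, ℝ) => t y) hw
      rw [h0, zero_mul] at this
      exact zero_ne_one this
    refine ⟨{y | e y = 1}, ⟨isClosed_eq e.continuous continuous_const, ?_⟩, ?_, ?_⟩
    · have : {y | e y = 1} = {y | e y = 0}ᶜ := by
        ext y
        rcases he' y with h | h <;> simp [h]
      rw [this]
      exact (isClosed_eq e.continuous continuous_const).isOpen_compl
    · refine (he' x).resolve_left fun h0 => hv' x ?_
      have : e x + v x = 0 := hf0
      linarith
    · intro y hy
      by_contra hyU
      refine hv' y ?_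
      have h1 : e y + v y = 1 := hf1 y hyU
      have h2 : e y = 1 := hy
      linarith
  · intro h f
    have hd : TotallyDisconnectedSpace X := by
      have : TotallySeparatedSpace X := by
        rw [totallySeparatedSpace_iff_exists_isClopen]
        intro x y hxy
        obtain ⟨U, hU, hxU, hUy⟩ := h.exists_subset_of_mem_open
          (show x ∈ ({y}ᶜ : Set X) from hxy) isOpen_compl_singleton
        exact ⟨U, hU, hxU, fun hy => hUy hy rfl⟩
      infer_instance
    obtain ⟨V, hV, h0, h1⟩ := exists_clopen_of_closed_subset_open
      (Z := {x | f x = 0}) (U := {x | f x ≠ 1}) (isClosed_eq f.continuous continuous_const)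
      (isClosed_eq f.continuous continuous_const).isOpen_compl
      (fun x (hx : f x = 0) => by simp [hx])
    let e : C(X, ℝ) := ⟨V.indicator 1, continuous_one.indicator fun x hx => by
      rw [hV.frontier_eq] at hx; exact hx.elim⟩
    refine ⟨e, f - e, ?_, ?_, by ring⟩
    · ext x
      by_cases hx : x ∈ V <;> simp [e, hx]
    · rw [ContinuousMap.isUnit_iff_forall_ne_zero]
      intro x
      by_cases hx : x ∈ V
      · have : f x ≠ 1 := h1 hx
        simpa [e, hx, sub_eq_zero] using this
      · have : f x ≠ 0 := fun h => hx (h0 h)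
        simpa [e, hx] using this

/-! ### Modal axioms on continuous functions and conditions on the relation -/

namespace KHFrame

variable {F : KHFrame.{u}}

theorem satD_toMBal_iff : F.toMBal.SatD ↔ F.SatD := by
  constructor
  · intro h x
    by_contra hx
    have h1 : F.boxFun 0 x = 0 := congrArg (fun t : C(F.carrier, ℝ) => t x) h
    rw [boxFun_of_not_exists hx] at h1
    exact one_ne_zero h1
  · intro h
    exact ContinuousMap.ext fun x => boxFun_zero (h x)

theorem satT_toMBal_iff : F.toMBal.SatT ↔ F.SatT := by
  constructor
  · intro h x
    by_contra hx
    obtain ⟨f, hf0, hf1⟩ := exists_continuous_zero_one (F.isContinuousRel.isClosed_image x) hx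
    have h1 : F.boxFun f x ≤ f x := h f x
    rw [boxFun_eq_one hf1, hf0] at h1
    exact absurd h1 (by norm_num)
  · intro h (f : C(F.carrier, ℝ)) x
    exact boxFun_le f (h x)

/-- The function inside the outer `□` is `□f` at points with successors and `f` at dead ends. At a
dead end `□f` is 1, which need not bound `□f` at a predecessor, whereas `f` does. -/
theorem satK4_toMBal_iff : F.toMBal.SatK4 ↔ F.SatK4 := by
  constructor
  · intro h x y z hxy hyz
    by_contra hxz
    obtain ⟨f, hf0, hf1⟩ := exists_continuous_zero_one (F.isContinuousRel.isClosed_image x) hxz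
    have h1 : F.boxFun f x ≤ F.boxFun (F.box f * (1 - F.box 0) + f * F.box 0) x := h f x
    have h2 := h1.trans (boxFun_le _ hxy)
    simp only [ContinuousMap.add_apply, ContinuousMap.mul_apply, ContinuousMap.sub_apply,
      ContinuousMap.one_apply, box_apply, boxFun_eq_one hf1, boxFun_zero ⟨z, hyz⟩] at h2
    have h3 := boxFun_le f hyz
    rw [hf0] at h3
    linarith
  · intro h (f : C(F.carrier, ℝ)) x
    change F.boxFun f x ≤ F.boxFun (F.box f * (1 - F.box 0) + f * F.box 0) x
    by_cases hx : ∃ y, F.rel x y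
    · refine le_boxFun hx fun y hy => ?_
      by_cases hy' : ∃ z, F.rel y z
      · obtain ⟨z, hz, e, -⟩ := exists_boxFun_eq f hy'
        simpa [boxFun_zero hy', e] using boxFun_le f (h x y z hy hz)
      · simpa [boxFun_of_not_exists hy'] using boxFun_le f hy
    · rw [boxFun_of_not_exists hx, boxFun_of_not_exists hx]

/-- At dead ends `◇□f` is 0 while `f` may be negative; the factor `1 - □0` vanishes there and makes
the inequality trivial. -/
theorem satB_toMBal_iff : F.toMBal.SatB ↔ F.SatB := by
  constructor
  · intro h x y hxy
    by_contra hyx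
    obtain ⟨f, hf0, hf1⟩ := exists_continuous_zero_one (F.isContinuousRel.isClosed_image y) hyx
    have h1 : (1 - F.boxFun (1 - F.box f) x) * (1 - F.boxFun 0 x) ≤ f x * (1 - F.boxFun 0 x) :=
      h f x
    rw [boxFun_zero ⟨y, hxy⟩, hf0] at h1
    have h2 : F.boxFun (1 - F.box f) x ≤ 1 - F.boxFun f y := boxFun_le (1 - F.box f) hxy
    rw [boxFun_eq_one hf1] at h2
    linarith
  · intro h (f : C(F.carrier, ℝ)) x
    change (1 - F.boxFun (1 - F.box f) x) * (1 - F.boxFun 0 x) ≤ f x * (1 - F.boxFun 0 x)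
    by_cases hx : ∃ y, F.rel x y
    · obtain ⟨y, hy, e, -⟩ := exists_boxFun_eq (1 - F.box f) hx
      have h1 : F.boxFun (1 - F.box f) x = 1 - F.boxFun f y := e
      have h2 := boxFun_le f (h x y hy)
      rw [boxFun_zero hx, h1]
      linarith
    · rw [boxFun_of_not_exists hx, boxFun_of_not_exists hx]
      simp

theorem sat_toMBal_iff (L : ModalLogic) : MBal.Sat L F.toMBal ↔ KHFrame.Sat L F := by
  cases L
  · exact satD_toMBal_iff
  · exact satT_toMBal_iff
  · exact satK4_toMBal_iff
  · exact satB_toMBal_iff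
  · exact and_congr satT_toMBal_iff satK4_toMBal_iff
  · exact and_congr (and_congr satT_toMBal_iff satK4_toMBal_iff) satB_toMBal_iff

end KHFrame

/-! ### Transport along isomorphisms -/

namespace MBal.Hom

variable {A B : MBal.{u}} (f : Hom A B)

theorem map_le {a b : A.carrier} (h : a ≤ b) : f.toAlgHom a ≤ f.toAlgHom b := by
  have h1 : f.toAlgHom (a ⊓ b) = f.toAlgHom a ⊓ f.toAlgHom b := f.map_inf' a b
  rw [inf_eq_left.2 h] at h1
  exact inf_eq_left.1 h1.symm

theorem map_box (a : A.carrier) : f.toAlgHom (A.box a) = B.box (f.toAlgHom a) := f.map_box' a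

theorem map_dia (a : A.carrier) : f.toAlgHom (A.dia a) = B.dia (f.toAlgHom a) := by
  simp [dia, map_box]

theorem satD {A B : MBal.{u}} (f : Hom A B) (h : A.SatD) : B.SatD := by
  have h1 := f.map_box 0
  rw [show A.box 0 = 0 from h, map_zero] at h1
  exact h1.symm

theorem satT (hf : Function.Surjective f.toAlgHom) (h : A.SatT) : B.SatT := by
  intro b
  obtain ⟨a, rfl⟩ := hf b
  rw [← map_box]
  exact f.map_le (h a)

theorem satK4 (hf : Function.Surjective f.toAlgHom) (h : A.SatK4) : B.SatK4 := by
  intro b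
  obtain ⟨a, rfl⟩ := hf b
  simpa [map_box] using f.map_le (h a)

theorem satB (hf : Function.Surjective f.toAlgHom) (h : A.SatB) : B.SatB := by
  intro b
  obtain ⟨a, rfl⟩ := hf b
  simpa [map_box, map_dia] using f.map_le (h a)

theorem sat (hf : Function.Surjective f.toAlgHom) (L : ModalLogic) (h : MBal.Sat L A) :
    MBal.Sat L B := by
  cases L
  · exact f.satD h
  · exact f.satT hf h
  · exact f.satK4 hf h
  · exact f.satB hf h
  · exact ⟨f.satT hf h.1, f.satK4 hf h.2⟩
  · exact ⟨⟨f.satT hf h.1.1, f.satK4 hf h.1.2⟩, f.satB hf h.2⟩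

/-- A bijective homomorphism is an isomorphism. -/
noncomputable def isoOfBijective (hf : Function.Bijective f.toAlgHom) : A ≅ B where
  hom := f
  inv :=
    { (AlgEquiv.ofBijective f.toAlgHom hf).symm.toAlgHom with
      map_inf' := fun a b => hf.1 (by
        have h := f.map_inf' ((AlgEquiv.ofBijective f.toAlgHom hf).symm a)
          ((AlgEquiv.ofBijective f.toAlgHom hf).symm b)
        have e := AlgEquiv.apply_symm_apply (AlgEquiv.ofBijective f.toAlgHom hf)
        exact (e _).trans ((congrArg₂ _ (e a) (e b)).symm.trans h.symm))
      map_sup' := fun a b => hf.1 (by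
        have h := f.map_sup' ((AlgEquiv.ofBijective f.toAlgHom hf).symm a)
          ((AlgEquiv.ofBijective f.toAlgHom hf).symm b)
        have e := AlgEquiv.apply_symm_apply (AlgEquiv.ofBijective f.toAlgHom hf)
        exact (e _).trans ((congrArg₂ _ (e a) (e b)).symm.trans h.symm))
      map_box' := fun a => hf.1 (by
        have h := f.map_box' ((AlgEquiv.ofBijective f.toAlgHom hf).symm a)
        have e := AlgEquiv.apply_symm_apply (AlgEquiv.ofBijective f.toAlgHom hf)
        exact (e _).trans ((congrArg _ (e a)).symm.trans h.symm)) }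
  hom_inv_id := Hom.ext (funext fun a =>
    AlgEquiv.symm_apply_apply (AlgEquiv.ofBijective f.toAlgHom hf) a)
  inv_hom_id := Hom.ext (funext fun a =>
    AlgEquiv.apply_symm_apply (AlgEquiv.ofBijective f.toAlgHom hf) a)

end MBal.Hom

theorem IsCleanRing.of_surjective {A B : Type u} [CommRing A] [CommRing B] (f : A →+* B)
    (hf : Function.Surjective f) (h : IsCleanRing A) : IsCleanRing B := by
  intro b
  obtain ⟨a, rfl⟩ := hf b
  obtain ⟨e, v, he, hv, rfl⟩ := h a
  exact ⟨f e, f v, he.map f, hv.map f, map_add f e v⟩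

/-! ### Existence of positive real-valued homomorphisms -/

section Cone

variable {A : Type u} [CommRing A] [Lattice A] [Algebra ℝ A]

theorem IsBoundedArchLAlg.isOrderedAddMonoid (h : IsBoundedArchLAlg A) : IsOrderedAddMonoid A where
  add_le_add_left a b hab c := h.add_le_add_right a b c hab

theorem IsBoundedArchLAlg.posSMulMono (h : IsBoundedArchLAlg A) : PosSMulMono ℝ A :=
  have := h.isOrderedAddMonoid
  .of_smul_nonneg fun r hr a ha => h.smul_nonneg r a hr ha

/-- Positivity of 1 is not an axiom. Some multiple `n • 1` dominates `|1|` and so is nonnegative;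
for positive `n`, scale by `1/n`. -/
theorem IsBoundedArchLAlg.zeroLEOneClass (h : IsBoundedArchLAlg A) : ZeroLEOneClass A where
  zero_le_one := by
    have := h.isOrderedAddMonoid
    have := h.posSMulMono
    obtain ⟨n, hn⟩ := h.bounded |(1 : A)|
    have hn' : (0 : A) ≤ n • 1 := (abs_nonneg _).trans hn
    rcases Nat.eq_zero_or_pos n with rfl | h0
    · rw [zero_smul] at hn
      exact neg_nonpos.1 ((neg_le_abs 1).trans hn)
    · have h1 : (0 : ℝ) < n := Nat.cast_pos.2 h0
      have h2 := _root_.smul_nonneg (inv_nonneg.2 h1.le) hn'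
      rwa [← Nat.cast_smul_eq_nsmul ℝ, smul_smul, inv_mul_cancel₀ h1.ne', one_smul] at h2

theorem IsBoundedArchLAlg.isOrderedRing (h : IsBoundedArchLAlg A) : IsOrderedRing A :=
  have := h.isOrderedAddMonoid
  have := h.zeroLEOneClass
  .of_mul_nonneg h.mul_nonneg

/-- Boundedness is what gives this: both parts lie below a multiple of 1, so a scaled copy of the
product lies below each of them, and their infimum is 0. -/
theorem posPart_mul_negPart_eq_zero (h : IsBoundedArchLAlg A) (a : A) : a⁺ * a⁻ = 0 := by
  have := h.isOrderedRing
  have := h.posSMulMono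
  obtain ⟨m, hm⟩ := h.bounded (a⁺ + a⁻)
  have hle {p q : A} (hp : 0 ≤ p) (hq : 0 ≤ q) (hpq : p + q ≤ m • (1 : A)) :
      ((m + 1 : ℝ)⁻¹ • (p * q)) ≤ q := by
    -- The bound `m` may be 0, and `m + 1` is invertible.
    have h0 : (0 : ℝ) < m + 1 := by positivity
    have h1 : p ≤ (m + 1 : ℝ) • (1 : A) := by
      rw [add_smul, one_smul, Nat.cast_smul_eq_nsmul]
      exact (le_add_of_nonneg_right hq).trans (hpq.trans (le_add_of_nonneg_right zero_le_one))
    have h2 := smul_le_smul_of_nonneg_left (mul_le_mul_of_nonneg_right h1 hq) (inv_nonneg.2 h0.le)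
    rwa [smul_mul_assoc, one_mul, smul_smul, inv_mul_cancel₀ h0.ne', one_smul] at h2
  have hp := posPart_nonneg a
  have hq := negPart_nonneg a
  have h1 := hle hp hq hm
  have h2 := hle hq hp (by rwa [add_comm])
  rw [mul_comm] at h2
  have h3 := le_inf h2 h1
  rw [posPart_inf_negPart_eq_zero] at h3
  have h0 : (0 : ℝ) < m + 1 := by positivity
  have h4 := smul_le_smul_of_nonneg_left h3 h0.le
  rw [smul_smul, mul_inv_cancel₀ h0.ne', one_smul, smul_zero] at h4
  exact le_antisymm h4 (mul_nonneg hp hq)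

theorem posPart_mul_self_eq (h : IsBoundedArchLAlg A) (a : A) : a⁺ * a = a⁺ * a⁺ := by
  have := h.isOrderedRing
  conv_lhs => rw [← posPart_sub_negPart a, posPart_sub_negPart a]
  nth_rw 2 [← posPart_sub_negPart a]
  rw [mul_sub, posPart_mul_negPart_eq_zero h, sub_zero]

theorem IsBoundedArchLAlg.mul_self_nonneg (h : IsBoundedArchLAlg A) (a : A) : 0 ≤ a * a := by
  have := h.isOrderedRing
  have h1 : a * a = a⁺ * a⁺ + a⁻ * a⁻ := by
    have h2 := posPart_mul_negPart_eq_zero h a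
    linear_combination (-2) * h2 - (a⁺ - a⁻ + a) * posPart_sub_negPart a
  rw [h1]
  exact add_nonneg (_root_.mul_nonneg (posPart_nonneg a) (posPart_nonneg a))
    (_root_.mul_nonneg (negPart_nonneg a) (negPart_nonneg a))

/-- Proper cones closed under multiplication that contain the nonnegative elements. -/
structure IsPosCone (P : Set A) : Prop where
  nonneg_mem : ∀ a, 0 ≤ a → a ∈ P
  add_mem : ∀ a b, a ∈ P → b ∈ P → a + b ∈ P
  mul_mem : ∀ a b, a ∈ P → b ∈ P → a * b ∈ P
  neg_one_notMem : (-1 : A) ∉ P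

/-- Products stay in the set because `c * c` is nonnegative, which absorbs the quadratic term into
`P`. -/
theorem IsPosCone.adjoin (h : IsBoundedArchLAlg A) {P : Set A} {c : A}
    (nonneg_mem : ∀ a, 0 ≤ a → a ∈ P)
    (add_mem : ∀ a b, a ∈ P → b ∈ P → a + b ∈ P)
    (mul_mem : ∀ a b, a ∈ P → b ∈ P → a * b ∈ P)
    (hc : ∀ p ∈ P, ∀ q ∈ P, p + c * q ≠ -1) :
    IsPosCone {a | ∃ p ∈ P, ∃ q ∈ P, p + c * q = a} where
  nonneg_mem a ha := ⟨a, nonneg_mem a ha, 0, nonneg_mem 0 le_rfl, by simp⟩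
  add_mem := by
    rintro _ _ ⟨p, hp, q, hq, rfl⟩ ⟨p', hp', q', hq', rfl⟩
    exact ⟨p + p', add_mem _ _ hp hp', q + q', add_mem _ _ hq hq', by ring⟩
  mul_mem := by
    rintro _ _ ⟨p, hp, q, hq, rfl⟩ ⟨p', hp', q', hq', rfl⟩
    exact ⟨p * p' + c * c * (q * q'), add_mem _ _ (mul_mem _ _ hp hp')
      (mul_mem _ _ (nonneg_mem _ (h.mul_self_nonneg c)) (mul_mem _ _ hq hq')),
      p * q' + q * p', add_mem _ _ (mul_mem _ _ hp hq') (mul_mem _ _ hq hp'), by ring⟩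
  neg_one_notMem := by
    rintro ⟨p, hp, q, hq, e⟩
    exact hc p hp q hq e

omit [Algebra ℝ A] in
theorem IsPosCone.exists_maximal {P : Set A} (hP : IsPosCone P) :
    ∃ Q, P ⊆ Q ∧ Maximal IsPosCone Q := by
  obtain ⟨Q, hPQ, hQ⟩ := zorn_subset_nonempty {Q : Set A | IsPosCone Q} (fun c hc hchain hne => by
    refine ⟨⋃₀ c, ⟨?_, ?_, ?_, ?_⟩, fun s hs => Set.subset_sUnion_of_mem hs⟩
    · intro a ha
      obtain ⟨s, hs⟩ := hne
      exact ⟨s, hs, (hc hs).nonneg_mem a ha⟩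
    · rintro a b ⟨s, hs, ha⟩ ⟨t, ht, hb⟩
      rcases hchain.total hs ht with hst | hst
      · exact ⟨t, ht, (hc ht).add_mem _ _ (hst ha) hb⟩
      · exact ⟨s, hs, (hc hs).add_mem _ _ ha (hst hb)⟩
    · rintro a b ⟨s, hs, ha⟩ ⟨t, ht, hb⟩
      rcases hchain.total hs ht with hst | hst
      · exact ⟨t, ht, (hc ht).mul_mem _ _ (hst ha) hb⟩
      · exact ⟨s, hs, (hc hs).mul_mem _ _ ha (hst hb)⟩
    · rintro ⟨s, hs, ha⟩
      exact (hc hs).neg_one_notMem ha) P hP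
  exact ⟨Q, hPQ, hQ⟩

theorem IsPosCone.mem_of_maximal (h : IsBoundedArchLAlg A) {P : Set A} (hP : Maximal IsPosCone P)
    {c : A} (hc : ∀ p ∈ P, ∀ q ∈ P, p + c * q ≠ -1) : c ∈ P := by
  have := h.zeroLEOneClass
  have h1 := IsPosCone.adjoin h hP.prop.nonneg_mem hP.prop.add_mem hP.prop.mul_mem hc
  refine hP.le_of_ge h1 (fun p hp => ⟨p, hp, 0, hP.prop.nonneg_mem 0 le_rfl, by simp⟩)
    ⟨0, hP.prop.nonneg_mem 0 le_rfl, 1, hP.prop.nonneg_mem 1 zero_le_one, by simp⟩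

/-- Otherwise `1 + p = -aq` and `1 + p' = aq'` with all coefficients in `P`. Multiplying the two
writes `-1` as `p + p' + pp' + a²qq'`, an element of `P`. -/
theorem IsPosCone.mem_or_neg_mem (h : IsBoundedArchLAlg A) {P : Set A}
    (hP : Maximal IsPosCone P) (a : A) : a ∈ P ∨ -a ∈ P := by
  by_contra! hn
  have h1 : ∃ p ∈ P, ∃ q ∈ P, p + a * q = -1 := by
    by_contra! hc
    exact hn.1 (IsPosCone.mem_of_maximal h hP hc)
  have h2 : ∃ p ∈ P, ∃ q ∈ P, p + (-a) * q = -1 := by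
    by_contra! hc
    exact hn.2 (IsPosCone.mem_of_maximal h hP hc)
  obtain ⟨p, hp, q, hq, e⟩ := h1
  obtain ⟨p', hp', q', hq', e'⟩ := h2
  apply hP.prop.neg_one_notMem
  have e'' : -1 = p + p' + p * p' + a * a * (q * q') := by
    linear_combination (-1 - p') * e + a * q * e'
  rw [e'']
  exact hP.prop.add_mem _ _ (hP.prop.add_mem _ _ (hP.prop.add_mem _ _ hp hp')
    (hP.prop.mul_mem _ _ hp hp')) (hP.prop.mul_mem _ _ (hP.prop.nonneg_mem _ (h.mul_self_nonneg a))
      (hP.prop.mul_mem _ _ hq hq'))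

/-! ### Characters from maximal cones -/

namespace IsPosCone

variable {P : Set A}

theorem algebraMap_mem (h : IsBoundedArchLAlg A) (hP : IsPosCone P) {r : ℝ} (hr : 0 ≤ r) :
    algebraMap ℝ A r ∈ P := by
  have := h.zeroLEOneClass
  refine hP.nonneg_mem _ ?_
  rw [Algebra.algebraMap_eq_smul_one]
  exact h.smul_nonneg r 1 hr zero_le_one

theorem smul_mem (h : IsBoundedArchLAlg A) (hP : IsPosCone P) {r : ℝ} (hr : 0 ≤ r) {a : A}
    (ha : a ∈ P) : r • a ∈ P := by
  rw [Algebra.smul_def]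
  exact hP.mul_mem _ _ (hP.algebraMap_mem h hr) ha

theorem nonneg_of_algebraMap_mem (h : IsBoundedArchLAlg A) (hP : IsPosCone P) {r : ℝ}
    (hr : algebraMap ℝ A r ∈ P) : 0 ≤ r := by
  by_contra! h0
  apply hP.neg_one_notMem
  have h1 := hP.smul_mem h (inv_nonneg.2 (neg_nonneg.2 h0.le)) hr
  rwa [Algebra.smul_def, ← map_mul, inv_neg, neg_mul, inv_mul_cancel₀ h0.ne, map_neg, map_one] at h1

/-- The elements that are infinitesimal with respect to a cone. -/
def IsInfinitesimal (P : Set A) (c : A) : Prop :=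
  ∀ ε : ℝ, 0 < ε → algebraMap ℝ A ε + c ∈ P ∧ algebraMap ℝ A ε - c ∈ P

theorem exists_bound (h : IsBoundedArchLAlg A) (hP : IsPosCone P) (a : A) :
    ∃ n : ℝ, 0 < n ∧ algebraMap ℝ A n + a ∈ P ∧ algebraMap ℝ A n - a ∈ P := by
  have := h.isOrderedRing
  obtain ⟨n, hn⟩ := h.bounded |a|
  have h1 : |a| ≤ algebraMap ℝ A (n + 1) := by
    refine hn.trans ?_
    simp
  refine ⟨n + 1, by positivity, hP.nonneg_mem _ ?_, hP.nonneg_mem _ ?_⟩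
  · have := (neg_le_abs a).trans h1
    rwa [neg_le_iff_add_nonneg] at this
  · exact sub_nonneg.2 ((le_abs_self a).trans h1)

theorem IsInfinitesimal.mul_left (h : IsBoundedArchLAlg A) (hP : IsPosCone P) {c : A}
    (hc : IsInfinitesimal P c) (b : A) : IsInfinitesimal P (b * c) := by
  obtain ⟨n, hn0, hn, hn'⟩ := hP.exists_bound h b
  intro ε hε
  obtain ⟨h1, h2⟩ := hc (ε / n) (by positivity)
  have e : algebraMap ℝ A ε = algebraMap ℝ A (ε / n) * algebraMap ℝ A n := by
    rw [← map_mul, div_mul_cancel₀ _ hn0.ne']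
  have e2 : algebraMap ℝ A (1 / 2) * 2 = 1 := by
    rw [← map_ofNat (algebraMap ℝ A) 2, ← map_mul]
    norm_num
  -- The identity `(ε/n + c)(n + b) + (ε/n - c)(n - b) = 2(ε + bc)`, and the same with `c` replaced
  -- by `-c`.
  constructor
  · have := hP.mul_mem _ _ (hP.algebraMap_mem h (r := 1 / 2) (by norm_num))
      (hP.add_mem _ _ (hP.mul_mem _ _ h1 hn) (hP.mul_mem _ _ h2 hn'))
    convert this using 1
    linear_combination e - (algebraMap ℝ A (ε / n) * algebraMap ℝ A n + b * c) * e2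
  · have := hP.mul_mem _ _ (hP.algebraMap_mem h (r := 1 / 2) (by norm_num))
      (hP.add_mem _ _ (hP.mul_mem _ _ h2 hn) (hP.mul_mem _ _ h1 hn'))
    convert this using 1
    linear_combination e - (algebraMap ℝ A (ε / n) * algebraMap ℝ A n - b * c) * e2

/-- The ideal of infinitesimal elements. -/
def infinitesimals (h : IsBoundedArchLAlg A) (hP : IsPosCone P) : Ideal A where
  carrier := {c | IsInfinitesimal P c}
  zero_mem' ε hε := by simpa using hP.algebraMap_mem h hε.le
  add_mem' {a b} ha hb ε hε := by
    obtain ⟨h1, h2⟩ := ha (ε / 2) (by positivity)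
    obtain ⟨h3, h4⟩ := hb (ε / 2) (by positivity)
    have e : algebraMap ℝ A ε = algebraMap ℝ A (ε / 2) + algebraMap ℝ A (ε / 2) := by
      rw [← map_add, add_halves]
    constructor
    · convert hP.add_mem _ _ h1 h3 using 1
      rw [e]
      ring
    · convert hP.add_mem _ _ h2 h4 using 1
      rw [e]
      ring
  smul_mem' b c hc := IsInfinitesimal.mul_left h hP hc b

/-- The real `r` is the supremum of the cut `{r | a - r ∈ P}`. Boundedness makes the cut nonempty
and bounded above, and totality of a maximal cone puts `r + ε - a` in `P`. -/
theorem exists_sub_mem_infinitesimals (h : IsBoundedArchLAlg A) (hP : Maximal IsPosCone P) (a : A) :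
    ∃ r : ℝ, a - algebraMap ℝ A r ∈ infinitesimals h hP.prop := by
  obtain ⟨n, -, hn, hn'⟩ := hP.prop.exists_bound h a
  let S : Set ℝ := {r | a - algebraMap ℝ A r ∈ P}
  have hne : S.Nonempty := ⟨-n, by simpa [S, add_comm] using hn⟩
  have hbdd : BddAbove S := by
    refine ⟨n, fun r hr => ?_⟩
    have h1 := hP.prop.add_mem _ _ hr hn'
    have h2 : algebraMap ℝ A (n - r) ∈ P := by
      convert h1 using 1
      rw [map_sub]
      ring
    linarith [hP.prop.nonneg_of_algebraMap_mem h h2]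
  refine ⟨sSup S, fun ε hε => ⟨?_, ?_⟩⟩
  · obtain ⟨r, hr, hlt⟩ := exists_lt_of_lt_csSup hne (sub_lt_self (sSup S) hε)
    have h1 := hP.prop.add_mem _ _ hr
      (hP.prop.algebraMap_mem h (r := r - (sSup S - ε)) (by linarith))
    convert h1 using 1
    simp only [map_sub]
    ring
  · have h1 : sSup S + ε ∉ S := fun hmem => by
      have := le_csSup hbdd hmem
      linarith
    have h2 := (mem_or_neg_mem h hP (a - algebraMap ℝ A (sSup S + ε))).resolve_left h1
    convert h2 using 1
    simp only [map_add]
    ring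

theorem exists_algHom (h : IsBoundedArchLAlg A) (hP : Maximal IsPosCone P) :
    ∃ x : A →ₐ[ℝ] ℝ, ∀ a ∈ P, 0 ≤ x a := by
  let I := infinitesimals h hP.prop
  have hI : I ≠ ⊤ := by
    rw [Ideal.ne_top_iff_one]
    intro h1
    have h2 := (h1 (1 / 2) (by norm_num)).2
    rw [← map_one (algebraMap ℝ A), ← map_sub] at h2
    have := hP.prop.nonneg_of_algebraMap_mem h h2
    norm_num at this
  have : Nontrivial (A ⧸ I) := Ideal.Quotient.nontrivial_iff.2 hI
  have hb : Function.Bijective (Algebra.ofId ℝ (A ⧸ I)) := by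
    refine ⟨(Algebra.ofId ℝ (A ⧸ I)).toRingHom.injective, fun q => ?_⟩
    obtain ⟨a, rfl⟩ := Ideal.Quotient.mk_surjective q
    obtain ⟨r, hr⟩ := exists_sub_mem_infinitesimals h hP a
    exact ⟨r, (Ideal.Quotient.eq.2 hr).symm⟩
  let E := AlgEquiv.ofBijective _ hb
  refine ⟨E.symm.toAlgHom.comp (Ideal.Quotient.mkₐ ℝ I), fun a ha => ?_⟩
  obtain ⟨r, hr⟩ := exists_sub_mem_infinitesimals h hP a
  have hx : E.symm (Ideal.Quotient.mk I a) = r := by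
    rw [AlgEquiv.symm_apply_eq]
    exact Ideal.Quotient.eq.2 hr
  change 0 ≤ E.symm (Ideal.Quotient.mk I a)
  rw [hx]
  by_contra! h0
  -- If `r < 0`, then `-r/2 - (a - r)` is in `P`; adding `a` gives the negative constant `r/2`.
  have h1 := hP.prop.add_mem _ _ (hr (-r / 2) (by linarith)).2 ha
  have h2 : algebraMap ℝ A (r / 2) ∈ P := by
    convert h1 using 1
    have : r / 2 = -r / 2 + r := by ring
    rw [this, map_add]
    ring
  linarith [hP.prop.nonneg_of_algebraMap_mem h h2]

end IsPosCone

/-- By the archimedean axiom some `c = na - 1` is not `≤ 0`. It can be adjoined to the positive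
cone: multiplying `p + cq = -1` by `c⁺` gives `c⁺ ≤ -c⁺p ≤ 0`, hence `c ≤ 0`. A character
nonnegative at `c` satisfies `n x(a) ≥ 1`. -/
theorem IsBoundedArchLAlg.exists_pos_algHom (h : IsBoundedArchLAlg A) {a : A} (ha : ¬ a ≤ 0) :
    ∃ x : A →ₐ[ℝ] ℝ, (∀ b, 0 ≤ b → 0 ≤ x b) ∧ 0 < x a := by
  have := h.isOrderedRing
  have := h.posSMulMono
  obtain ⟨n, hn⟩ : ∃ n : ℕ, ¬ n • a ≤ 1 := by
    by_contra! hn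
    exact ha (h.archimedean a 1 hn)
  let c := n • a - 1
  obtain ⟨Q, hQ, hQm⟩ := (IsPosCone.adjoin h (P := {b : A | 0 ≤ b}) (c := c) (fun _ => id)
    (fun _ _ => add_nonneg) (fun _ _ => _root_.mul_nonneg) (by
      intro p hp q hq e
      have h1 : c⁺ * c⁺ * q = -(c⁺ * p) - c⁺ := by
        rw [← posPart_mul_self_eq h]
        linear_combination c⁺ * e
      have h2 : 0 ≤ c⁺ * c⁺ * q := _root_.mul_nonneg (h.mul_self_nonneg _) hq
      rw [h1] at h2
      have h3 : c⁺ ≤ -(c⁺ * p) := sub_nonneg.1 h2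
      have h4 : c⁺ ≤ 0 := h3.trans (neg_nonpos.2 (_root_.mul_nonneg (posPart_nonneg c) hp))
      exact hn (sub_nonpos.1 ((le_posPart c).trans h4)))).exists_maximal
  obtain ⟨x, hx⟩ := IsPosCone.exists_algHom h hQm
  refine ⟨x, fun b hb => hx b (hQm.prop.nonneg_mem b hb), ?_⟩
  have h1 := hx c (hQ ⟨0, le_refl (0 : A), 1, zero_le_one' A, by simp⟩)
  rw [map_sub, map_nsmul, map_one, nsmul_eq_mul] at h1
  by_contra! h0
  have := mul_nonpos_of_nonneg_of_nonpos (Nat.cast_nonneg (α := ℝ) n) h0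
  linarith

end Cone

/-! ### The spectrum of a bounded archimedean `ℓ`-algebra -/

section Spectrum

/-- Positive homomorphisms to `ℝ`. -/
def PosSpectrum (A : Type u) [CommRing A] [Lattice A] [Algebra ℝ A] : Type u :=
  {x : A →ₐ[ℝ] ℝ // ∀ a, 0 ≤ a → 0 ≤ x a}

namespace PosSpectrum

variable {A : Type u} [CommRing A] [Lattice A] [Algebra ℝ A]

instance : FunLike (PosSpectrum A) A ℝ where
  coe x := x.1
  coe_injective _ _ h := Subtype.ext (DFunLike.coe_injective h)

instance : AlgHomClass (PosSpectrum A) ℝ A ℝ where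
  map_mul x := map_mul x.1
  map_one x := map_one x.1
  map_add x := map_add x.1
  map_zero x := map_zero x.1
  commutes x := x.1.commutes

theorem map_algebraMap (x : PosSpectrum A) (r : ℝ) : x (algebraMap ℝ A r) = r := x.1.commutes r

instance : TopologicalSpace (PosSpectrum A) :=
  TopologicalSpace.induced (fun x a => x a) inferInstance

theorem isInducing_coe : Topology.IsInducing (fun (x : PosSpectrum A) (a : A) => x a) := ⟨rfl⟩

theorem continuous_eval (a : A) : Continuous fun x : PosSpectrum A => x a :=
  (continuous_apply a).comp isInducing_coe.continuous

instance : T2Space (PosSpectrum A) :=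
  T2Space.of_injective_continuous (f := fun (x : PosSpectrum A) (a : A) => x a)
    DFunLike.coe_injective isInducing_coe.continuous

theorem isClosed_range_coe :
    IsClosed (Set.range fun (x : PosSpectrum A) (a : A) => x a) := by
  have : (Set.range fun (x : PosSpectrum A) (a : A) => x a) =
      {g | g 1 = 1} ∩ (⋂ a, ⋂ b, {g : A → ℝ | g (a + b) = g a + g b}) ∩
      (⋂ a, ⋂ b, {g : A → ℝ | g (a * b) = g a * g b}) ∩
      (⋂ r : ℝ, ⋂ a, {g : A → ℝ | g (r • a) = r * g a}) ∩
      (⋂ a, ⋂ _ : 0 ≤ a, {g : A → ℝ | 0 ≤ g a}) := by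
    ext g
    simp only [Set.mem_range, Set.mem_inter_iff, Set.mem_iInter, Set.mem_ofPred_eq]
    constructor
    · rintro ⟨x, rfl⟩
      exact ⟨⟨⟨⟨map_one x, map_add x⟩, map_mul x⟩, map_smul x⟩, x.2⟩
    · rintro ⟨⟨⟨⟨h1, h2⟩, h3⟩, h4⟩, h5⟩
      exact ⟨⟨AlgHom.ofLinearMap ⟨⟨g, h2⟩, h4⟩ h1 h3, h5⟩, rfl⟩
  rw [this]
  refine IsClosed.inter (IsClosed.inter (IsClosed.inter (IsClosed.inter ?_ ?_) ?_) ?_) ?_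
  · exact isClosed_eq (continuous_apply _) continuous_const
  · exact isClosed_iInter fun a => isClosed_iInter fun b =>
      isClosed_eq (continuous_apply _) ((continuous_apply a).add (continuous_apply b))
  · exact isClosed_iInter fun a => isClosed_iInter fun b =>
      isClosed_eq (continuous_apply _) ((continuous_apply a).mul (continuous_apply b))
  · exact isClosed_iInter fun a => isClosed_iInter fun b =>
      isClosed_eq (continuous_apply _) (continuous_const.mul (continuous_apply _))
  · exact isClosed_iInter fun a => isClosed_iInter fun b =>
      isClosed_le continuous_const (continuous_apply _)

theorem map_le (h : IsBoundedArchLAlg A) (x : PosSpectrum A) {a b : A} (hab : a ≤ b) :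
    x a ≤ x b := by
  have := h.isOrderedAddMonoid
  have h1 : 0 ≤ x (b - a) := x.2 _ (sub_nonneg.2 hab)
  rw [map_sub] at h1
  linarith

theorem compactSpace (h : IsBoundedArchLAlg A) : CompactSpace (PosSpectrum A) := by
  choose n hn using h.bounded
  rw [← isCompact_univ_iff, isInducing_coe.isCompact_iff, Set.image_univ]
  refine (isCompact_univ_pi fun a => isCompact_Icc (a := -(n (-a) : ℝ)) (b := n a)).of_isClosed_subset
    isClosed_range_coe ?_
  rintro _ ⟨x, rfl⟩ a -
  have h1 := map_le h x (hn a)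
  have h2 := map_le h x (hn (-a))
  rw [map_nsmul, map_one, nsmul_eq_mul, mul_one] at h1 h2
  rw [map_neg] at h2
  exact ⟨neg_le.1 h2, h1⟩

theorem le_iff (h : IsBoundedArchLAlg A) {a b : A} : a ≤ b ↔ ∀ x : PosSpectrum A, x a ≤ x b := by
  have := h.isOrderedAddMonoid
  refine ⟨fun hab x => map_le h x hab, fun hab => ?_⟩
  by_contra hn
  obtain ⟨x, hx, hx'⟩ := h.exists_pos_algHom (a := a - b) (fun h0 => hn (sub_nonpos.1 h0))
  have := hab ⟨x, hx⟩
  have h1 : x a ≤ x b := this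
  rw [map_sub] at hx'
  linarith

/-- Since `a⁺a⁻ = 0`, one of `x(a⁺)` and `x(a⁻)` vanishes, so positivity alone makes characters
preserve the lattice operations. -/
theorem map_posPart (h : IsBoundedArchLAlg A) (x : PosSpectrum A) (a : A) :
    x (a⁺) = x a ⊔ 0 := by
  have h1 : x (a⁺) * x (a⁻) = 0 := by
    rw [← map_mul, posPart_mul_negPart_eq_zero h, map_zero]
  have := h.isOrderedAddMonoid
  have h2 : x (a⁺) - x (a⁻) = x a := by
    rw [← map_sub, posPart_sub_negPart]
  have h3 : 0 ≤ x (a⁺) := x.2 _ (posPart_nonneg a)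
  have h4 : 0 ≤ x (a⁻) := x.2 _ (negPart_nonneg a)
  rcases mul_eq_zero.1 h1 with h5 | h5
  · rw [h5, sup_eq_right.2]
    linarith
  · rw [h5, sub_zero] at h2
    rw [h2, sup_eq_left.2]
    linarith

theorem map_sup (h : IsBoundedArchLAlg A) (x : PosSpectrum A) (a b : A) :
    x (a ⊔ b) = x a ⊔ x b := by
  have := h.isOrderedAddMonoid
  have e : a ⊔ b = (a - b)⁺ + b := by
    rw [posPart_def, sup_add, sub_add_cancel, zero_add]
  rw [e, map_add, map_posPart h, map_sub, max_add, sub_add_cancel, zero_add]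

theorem map_inf (h : IsBoundedArchLAlg A) (x : PosSpectrum A) (a b : A) :
    x (a ⊓ b) = x a ⊓ x b := by
  have := h.isOrderedAddMonoid
  have e := congrArg x (inf_add_sup a b)
  rw [map_add, map_add, map_sup h] at e
  have e' := inf_add_sup (x a) (x b)
  linarith

/-- The homomorphism to continuous functions on the spectrum. -/
def eval : A →ₐ[ℝ] C(PosSpectrum A, ℝ) where
  toFun a := ⟨fun x => x a, continuous_eval a⟩
  map_one' := ContinuousMap.ext fun x => map_one x
  map_zero' := ContinuousMap.ext fun x => map_zero x
  map_add' a b := ContinuousMap.ext fun x => map_add x a b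
  map_mul' a b := ContinuousMap.ext fun x => map_mul x a b
  commutes' r := ContinuousMap.ext fun x => map_algebraMap x r

theorem eval_injective (h : IsBoundedArchLAlg A) : Function.Injective (eval (A := A)) := by
  intro a b hab
  have hx (x : PosSpectrum A) : x a = x b := congrArg (fun t : C(PosSpectrum A, ℝ) => t x) hab
  exact le_antisymm ((le_iff h).2 fun x => (hx x).le) ((le_iff h).2 fun x => (hx x).ge)

theorem unifNorm_eval (h : IsBoundedArchLAlg A) (a : A) : unifNorm (eval a) = unifNorm a := by
  have hset : {r : ℝ | |eval a| ≤ algebraMap ℝ C(PosSpectrum A, ℝ) r} =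
      {r : ℝ | |a| ≤ algebraMap ℝ A r} := by
    ext r
    change (∀ x : PosSpectrum A, x a ⊔ -(x a) ≤ r) ↔ _
    rw [Set.mem_ofPred_eq, le_iff h]
    refine forall_congr' fun x => ?_
    rw [map_algebraMap, abs, map_sup h, map_neg]
  rw [unifNorm, hset, unifNorm]

/-- The image separates points, so it is dense by Stone-Weierstrass. Evaluation is isometric, so a
Cauchy sequence of preimages has a limit in `A`. -/
theorem eval_surjective (h : IsBoundedArchLAlg A) (hc : IsUniformlyComplete A) :
    Function.Surjective (eval (A := A)) := by
  have := compactSpace h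
  intro f
  have hsep : (eval (A := A)).range.SeparatesPoints := by
    intro x y hxy
    obtain ⟨a, ha⟩ := DFunLike.ne_iff.1 hxy
    exact ⟨eval a, ⟨eval a, ⟨a, rfl⟩, rfl⟩, ha⟩
  have hf := ContinuousMap.continuousMap_mem_subalgebra_closure_of_separatesPoints _ hsep f
  have hf' : f ∈ closure (Set.range (eval (A := A))) := hf
  obtain ⟨s, hs, hlim⟩ := mem_closure_iff_seq_limit.1 hf'
  choose t ht using hs
  have hnorm (a b : A) : unifNorm (a - b) = dist (eval a) (eval b) := by
    rw [← unifNorm_eval h, unifNorm_continuousMap, map_sub, dist_eq_norm]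
  obtain ⟨a, ha⟩ := hc t fun ε hε => by
    obtain ⟨N, hN⟩ := Metric.cauchySeq_iff.1 hlim.cauchySeq ε hε
    refine ⟨N, fun m n hm hn => ?_⟩
    rw [hnorm, ht, ht]
    exact hN m hm n hn
  refine ⟨a, tendsto_nhds_unique ?_ hlim⟩
  rw [Metric.tendsto_atTop]
  intro ε hε
  obtain ⟨N, hN⟩ := ha ε hε
  refine ⟨N, fun n hn => ?_⟩
  rw [← ht, ← hnorm]
  exact hN n hn

end PosSpectrum

end Spectrum

/-! ### The frame of a modal `ℓ`-algebra -/

namespace MBal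

variable (A : MBal.{u})

/-- The relation on the spectrum. -/
def specRel (x y : PosSpectrum A.carrier) : Prop := ∀ a, x (A.box a) ≤ y a

variable {A}

theorem box_zero_eq_mul (a : A.carrier) : A.box 0 = A.box 0 * A.box a := by
  have := A.isModalOperator.box_smul 0 a le_rfl
  rwa [zero_smul, map_zero] at this

theorem eval_box_zero (x : PosSpectrum A.carrier) : x (A.box 0) = 0 ∨ x (A.box 0) = 1 := by
  have h := congrArg x (box_zero_eq_mul (A := A) 0)
  rw [map_mul] at h
  rcases mul_eq_zero.1 (show x (A.box 0) * (x (A.box 0) - 1) = 0 by linarith) with h1 | h1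
  · exact Or.inl h1
  · exact Or.inr (by linarith)

theorem eval_box_eq_one {x : PosSpectrum A.carrier} (hx : x (A.box 0) = 1) (a : A.carrier) :
    x (A.box a) = 1 := by
  have h := congrArg x (box_zero_eq_mul a)
  rw [map_mul, hx, one_mul] at h
  exact h.symm

theorem eval_box_zero_of_specRel {x y : PosSpectrum A.carrier} (h : A.specRel x y) :
    x (A.box 0) = 0 := by
  refine (eval_box_zero x).resolve_right fun h1 => ?_
  have := h 0
  rw [map_zero, h1] at this
  exact absurd this (by norm_num)

section Zero

variable {x : PosSpectrum A.carrier} (hx : x (A.box 0) = 0)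
include hx

theorem eval_box_algebraMap (r : ℝ) : x (A.box (algebraMap ℝ A.carrier r)) = r := by
  rw [A.isModalOperator.box_real, map_add, map_mul, hx, mul_zero, add_zero,
    PosSpectrum.map_algebraMap]

theorem eval_box_add (a : A.carrier) (r : ℝ) :
    x (A.box (a + algebraMap ℝ A.carrier r)) = x (A.box a) + r := by
  rw [A.isModalOperator.box_add_real, map_sub, map_add, hx, eval_box_algebraMap hx, sub_zero]

theorem eval_box_smul (a : A.carrier) {r : ℝ} (hr : 0 ≤ r) :
    x (A.box (r • a)) = r * x (A.box a) := by
  rw [A.isModalOperator.box_smul r a hr, map_mul, eval_box_algebraMap hx]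

omit hx in
theorem eval_box_inf (a b : A.carrier) : x (A.box (a ⊓ b)) = x (A.box a) ⊓ x (A.box b) := by
  rw [A.isModalOperator.box_inf, PosSpectrum.map_inf A.isBal]

omit hx in
theorem eval_box_mono {a b : A.carrier} (hab : a ≤ b) : x (A.box a) ≤ x (A.box b) := by
  have h := eval_box_inf (x := x) a b
  rw [inf_eq_left.2 hab] at h
  exact inf_eq_left.1 h.symm

/-- Subtracting constants reduces the claim to finding `y` with `y(b) ≤ 0` and `y(c) ≥ 0` whenever
`x(□c) ≥ 0`. Compactness of the spectrum supplies it. -/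
theorem exists_specRel_eval_eq (a : A.carrier) :
    ∃ y, A.specRel x y ∧ y a = x (A.box a) := by
  have := PosSpectrum.compactSpace A.isBal
  have := A.isBal.isOrderedAddMonoid
  have hsub (d : A.carrier) : x (A.box (d - algebraMap ℝ A.carrier (x (A.box d)))) = 0 := by
    rw [sub_eq_add_neg, ← map_neg, eval_box_add hx, add_neg_cancel]
  let b := a - algebraMap ℝ A.carrier (x (A.box a))
  let ι := {c : A.carrier // 0 ≤ x (A.box c)} × ℕ
  have : Nonempty ι := ⟨⟨⟨0, hx.ge⟩, 0⟩⟩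
  -- One inequality encodes both requirements: `c = 0` and large `n` force `y(b) ≤ 0`, while for
  -- fixed `c` a negative `y(c)` would drive the right side to `-∞`. The sets are directed through
  -- `c ⊓ d` and `max m n`. If one were empty, then `n(c ⊓ 0) + 1/(n+1) ≤ b`; the modal axioms
  -- evaluate `x(□·)` on this combination, giving `1/(n+1) ≤ x(□b) = 0`.
  let W : ι → Set (PosSpectrum A.carrier) := fun i =>
    {y | y b ≤ ((i.2 : ℝ) + 1)⁻¹ + i.2 * (y i.1.1 ⊓ 0)}
  have hclosed (i : ι) : IsClosed (W i) :=
    isClosed_le (PosSpectrum.continuous_eval _) (continuous_const.add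
      (continuous_const.mul ((PosSpectrum.continuous_eval _).inf continuous_const)))
  obtain ⟨y, hy⟩ := IsCompact.nonempty_iInter_of_directed_nonempty_isCompact_isClosed W
    (by
      rintro ⟨⟨c, hc⟩, m⟩ ⟨⟨d, hd⟩, n⟩
      refine ⟨⟨⟨c ⊓ d, by rw [eval_box_inf]; exact le_inf hc hd⟩, m ⊔ n⟩, ?_, ?_⟩
      · intro y (hy : y b ≤ _)
        refine hy.trans ?_
        have hmn : (m : ℝ) ≤ (m ⊔ n : ℕ) := Nat.cast_le.2 le_sup_left
        have h0 : y (c ⊓ d) ⊓ 0 ≤ y c ⊓ 0 :=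
          inf_le_inf_right _ (PosSpectrum.map_le A.isBal y inf_le_left)
        have h1 : ((m ⊔ n : ℕ) : ℝ) * (y (c ⊓ d) ⊓ 0) ≤ m * (y c ⊓ 0) :=
          (mul_le_mul_of_nonpos_right hmn inf_le_right).trans
            (mul_le_mul_of_nonneg_left h0 (Nat.cast_nonneg _))
        exact add_le_add (inv_anti₀ (by positivity) (by linarith)) h1
      · intro y (hy : y b ≤ _)
        refine hy.trans ?_
        have hmn : (n : ℝ) ≤ (m ⊔ n : ℕ) := Nat.cast_le.2 le_sup_right
        have h0 : y (c ⊓ d) ⊓ 0 ≤ y d ⊓ 0 :=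
          inf_le_inf_right _ (PosSpectrum.map_le A.isBal y inf_le_right)
        have h1 : ((m ⊔ n : ℕ) : ℝ) * (y (c ⊓ d) ⊓ 0) ≤ n * (y d ⊓ 0) :=
          (mul_le_mul_of_nonpos_right hmn inf_le_right).trans
            (mul_le_mul_of_nonneg_left h0 (Nat.cast_nonneg _))
        exact add_le_add (inv_anti₀ (by positivity) (by linarith)) h1)
    (by
      rintro ⟨⟨c, hc⟩, n⟩
      by_contra hn
      rw [Set.not_nonempty_iff_eq_empty, Set.eq_empty_iff_forall_notMem] at hn
      have h1 : (n : ℝ) • (c ⊓ 0) + algebraMap ℝ A.carrier ((n : ℝ) + 1)⁻¹ ≤ b := by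
        rw [PosSpectrum.le_iff A.isBal]
        intro y
        have h2 : ¬ y b ≤ ((n : ℝ) + 1)⁻¹ + n * (y c ⊓ 0) := hn y
        rw [map_add, map_smul, PosSpectrum.map_algebraMap, PosSpectrum.map_inf A.isBal, map_zero,
          smul_eq_mul]
        linarith
      have h2 := eval_box_mono (x := x) h1
      rw [eval_box_add hx, eval_box_smul hx _ (Nat.cast_nonneg n), eval_box_inf, hx,
        inf_eq_right.2 hc, mul_zero, zero_add, hsub] at h2
      have : (0 : ℝ) < ((n : ℝ) + 1)⁻¹ := by positivity
      linarith)
    (fun i => (hclosed i).isCompact) hclosed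
  rw [Set.mem_iInter] at hy
  have hy' (c : A.carrier) (hc : 0 ≤ x (A.box c)) (n : ℕ) :
      y b ≤ ((n : ℝ) + 1)⁻¹ + n * (y c ⊓ 0) := hy ⟨⟨c, hc⟩, n⟩
  have hrel : A.specRel x y := by
    intro d
    have h1 := hy' _ (hsub d).ge
    by_contra! hlt
    rw [map_sub y d, PosSpectrum.map_algebraMap, inf_eq_left.2 (sub_neg.2 hlt).le] at h1
    obtain ⟨n, hn⟩ := exists_nat_gt ((1 - y b) / (x (A.box d) - y d))
    rw [div_lt_iff₀ (by linarith)] at hn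
    have h2 := h1 n
    have h3 : ((n : ℝ) + 1)⁻¹ ≤ 1 := inv_le_one_of_one_le₀ (by simp)
    linarith
  refine ⟨y, hrel, le_antisymm ?_ (hrel a)⟩
  have h1 : y b ≤ 0 := by
    refine ge_of_tendsto' (f := fun n : ℕ => ((n : ℝ) + 1)⁻¹) (x := Filter.atTop) ?_ fun n => ?_
    · simpa [one_div] using tendsto_one_div_add_atTop_nhds_zero_nat (𝕜 := ℝ)
    · simpa using hy' 0 hx.ge n
  rw [map_sub, PosSpectrum.map_algebraMap] at h1
  linarith

end Zero

/-- Closed preimages are projections of closed sets along a compact factor. For open `U` and `y ∈ U`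
with `x R y`, take `a` with `y(a) = 0` and `a = 1` off `U`. The condition `z(□a) < 1` is open and
holds at `x`, and it gives `z` a successor `w` with `w(a) < 1`, hence `w ∈ U`. -/
theorem isContinuousRel_specRel (hc : IsUniformlyComplete A.carrier) :
    IsContinuousRel A.specRel := by
  have := PosSpectrum.compactSpace A.isBal
  refine ⟨fun x => ?_, fun F hF => ?_, fun U hU => ?_⟩
  · simp only [specRel, Set.ofPred_forall]
    exact isClosed_iInter fun a => isClosed_le continuous_const (PosSpectrum.continuous_eval _)
  · have hG : IsClosed {p : PosSpectrum A.carrier × PosSpectrum A.carrier |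
        p.2 ∈ F ∧ A.specRel p.1 p.2} := by
      refine (hF.preimage continuous_snd).inter
        (s₂ := {p : PosSpectrum A.carrier × PosSpectrum A.carrier | A.specRel p.1 p.2}) ?_
      simp only [specRel, Set.ofPred_forall]
      exact isClosed_iInter fun a => isClosed_le
        ((PosSpectrum.continuous_eval _).comp continuous_fst)
        ((PosSpectrum.continuous_eval _).comp continuous_snd)
    convert isClosedMap_fst_of_compactSpace _ hG using 1
    ext x
    simp
  · rw [isOpen_iff_mem_nhds]
    rintro x ⟨y, hyU, hxy⟩
    obtain ⟨f, hf0, hf1⟩ := KHFrame.exists_continuous_zero_one hU.isClosed_compl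
      (fun hn => hn hyU : y ∉ Uᶜ)
    obtain ⟨a, rfl⟩ := PosSpectrum.eval_surjective A.isBal hc f
    have hx : x (A.box a) < 1 := (hxy a).trans_lt (by
      have : y a = 0 := hf0
      rw [this]; exact zero_lt_one)
    filter_upwards [(isOpen_Iio.preimage (PosSpectrum.continuous_eval (A.box a))).mem_nhds hx]
      with z (hz : z (A.box a) < 1)
    have h0 := (eval_box_zero z).resolve_right fun h1 => by
      rw [eval_box_eq_one h1] at hz
      exact lt_irrefl _ hz
    obtain ⟨w, hw, e⟩ := exists_specRel_eval_eq h0 a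
    refine ⟨w, ?_, hw⟩
    by_contra hn
    have h1 : w a = 1 := hf1 w hn
    rw [← e, h1] at hz
    exact lt_irrefl _ hz

/-- The compact Hausdorff frame of a uniformly complete modal `ℓ`-algebra. -/
def spec (A : MBal.{u}) (hc : IsUniformlyComplete A.carrier) : KHFrame.{u} :=
  have := PosSpectrum.compactSpace A.isBal
  { carrier := PosSpectrum A.carrier
    rel := A.specRel
    isContinuousRel := isContinuousRel_specRel hc }

/-- Evaluation on the spectrum preserves `□`. -/
noncomputable def evalHom (hc : IsUniformlyComplete A.carrier) : Hom A (A.spec hc).toMBal where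
  toAlgHom := PosSpectrum.eval
  map_inf' a b := ContinuousMap.ext fun x => PosSpectrum.map_inf A.isBal x a b
  map_sup' a b := ContinuousMap.ext fun x => PosSpectrum.map_sup A.isBal x a b
  map_box' a := by
    refine ContinuousMap.ext fun (x : PosSpectrum A.carrier) => ?_
    change x (A.box a) = (A.spec hc).boxFun (PosSpectrum.eval a) x
    rcases eval_box_zero x with h0 | h1
    · obtain ⟨y, hy, e⟩ := exists_specRel_eval_eq h0 a
      rw [← e]
      exact (KHFrame.boxFun_eq_of_isMin (F := A.spec hc) (f := PosSpectrum.eval a) hy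
        fun z hz => e.trans_le (hz a)).symm
    · rw [eval_box_eq_one h1]
      refine (KHFrame.boxFun_of_not_exists (F := A.spec hc) ?_).symm
      rintro ⟨y, hy⟩
      rw [eval_box_zero_of_specRel hy] at h1
      exact zero_ne_one h1

theorem evalHom_bijective (hc : IsUniformlyComplete A.carrier) :
    Function.Bijective (evalHom hc).toAlgHom :=
  ⟨PosSpectrum.eval_injective A.isBal, PosSpectrum.eval_surjective A.isBal hc⟩

end MBal

/-! ### The two dualities for modal `ℓ`-algebras -/

theorem nonempty_mubalCat_op_equivalence (L : ModalLogic) :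
    Nonempty ((MubalCat.{u} L)ᵒᵖ ≌ KHFCat.{u} L) := by
  refine nonempty_dualEquivalence KHFrame.toMBalFunctor _ _ ?_ ?_ ?_ ?_
  · exact fun F hF => ⟨isUniformlyComplete_continuousMap _, (KHFrame.sat_toMBal_iff L).2 hF⟩
  · exact fun F G _ _ => KHFrame.toMBalFunctor_map_injective F G
  · exact fun F G _ _ => KHFrame.toMBalFunctor_map_surjective F G
  · rintro A ⟨hc, hL⟩
    have hb := MBal.evalHom_bijective hc
    exact ⟨A.spec hc, (KHFrame.sat_toMBal_iff L).1 ((MBal.evalHom hc).sat hb.2 L hL),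
      ⟨((MBal.evalHom hc).isoOfBijective hb).symm⟩⟩

theorem nonempty_mcubalCat_op_equivalence (L : ModalLogic) :
    Nonempty ((McubalCat.{u} L)ᵒᵖ ≌ DFCat.{u} L) := by
  refine nonempty_dualEquivalence KHFrame.toMBalFunctor _ _ ?_ ?_ ?_ ?_
  · exact fun F hF => ⟨⟨isUniformlyComplete_continuousMap _,
      (isCleanRing_continuousMap_iff _).2 hF.1⟩, (KHFrame.sat_toMBal_iff L).2 hF.2⟩
  · exact fun F G _ _ => KHFrame.toMBalFunctor_map_injective F G
  · exact fun F G _ _ => KHFrame.toMBalFunctor_map_surjective F G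
  · rintro A ⟨⟨hc, hcl⟩, hL⟩
    have hb := MBal.evalHom_bijective hc
    exact ⟨A.spec hc, ⟨(isCleanRing_continuousMap_iff _).1
      (hcl.of_surjective (MBal.evalHom hc).toAlgHom.toRingHom hb.2),
      (KHFrame.sat_toMBal_iff L).1 ((MBal.evalHom hc).sat hb.2 L hL)⟩,
      ⟨((MBal.evalHom hc).isoOfBijective hb).symm⟩⟩

/-! ### The modal algebra of clopen sets -/

namespace KHFrame

open TopologicalSpace (Clopens)

section Clopens

variable (F : KHFrame.{u})

/-- The clopen set of all points with `R[x] ⊆ U`. -/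
def clopenBox (U : Clopens F.carrier) : Clopens F.carrier where
  carrier := {x | ∀ y, F.rel x y → y ∈ U}
  isClopen' := by
    have : {x | ∀ y, F.rel x y → y ∈ U} = {x | ∃ y ∈ (U : Set F.carrier)ᶜ, F.rel x y}ᶜ := by
      ext x
      simp only [Set.mem_ofPred_eq, Set.mem_compl_iff, not_exists, not_and, SetLike.mem_coe]
      exact forall_congr' fun y => ⟨fun h hn hr => hn (h hr), fun h hr => by_contra fun hn => h hn hr⟩
    rw [this]
    exact IsClopen.compl ⟨F.isContinuousRel.isClosed_preimage _ U.isClopen.compl.isClosed,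
      F.isContinuousRel.isOpen_preimage _ U.isClopen.compl.isOpen⟩

/-- The modal algebra of clopen sets of a compact Hausdorff frame. -/
def clopenAlg : ModalAlg.{u} where
  carrier := Clopens F.carrier
  box := F.clopenBox
  box_inf U V := SetLike.ext (p := F.clopenBox (U ⊓ V)) (q := F.clopenBox U ⊓ F.clopenBox V)
    fun _ => ⟨fun h => ⟨fun y hy => (h y hy).1, fun y hy => (h y hy).2⟩,
      fun h y hy => ⟨h.1 y hy, h.2 y hy⟩⟩
  box_top := SetLike.ext fun _ => ⟨fun _ => trivial, fun _ _ _ => trivial⟩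

end Clopens

/-- The inverse image under a morphism of frames. -/
def Hom.toModalAlgHom {F G : KHFrame.{u}} (f : Hom F G) :
    ModalAlg.Hom G.clopenAlg F.clopenAlg where
  toFun (U : Clopens G.carrier) := (⟨f.toFun ⁻¹' U, U.isClopen.preimage f.continuous_toFun⟩ :
    Clopens F.carrier)
  map_sup' _ _ := rfl
  map_inf' _ _ := rfl
  map_top' := rfl
  map_bot' := rfl
  map_box' (U : Clopens G.carrier) := by
    refine SetLike.ext (p := (_ : Clopens F.carrier)) (q := (_ : Clopens F.carrier)) fun x => ?_
    constructor
    · exact fun h y hy => h _ (f.rel_map hy)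
    · intro h z hz
      obtain ⟨y, hy, rfl⟩ := f.exists_rel hz
      exact h y hy

/-- The contravariant functor of clopen sets. -/
def clopenFunctor : KHFrame.{u} ⥤ ModalAlg.{u}ᵒᵖ where
  obj F := Opposite.op F.clopenAlg
  map f := Quiver.Hom.op (Hom.toModalAlgHom f)
  map_id _ := rfl
  map_comp _ _ := rfl

/-! ### Full faithfulness of the clopen functor on Stone frames -/

theorem IsStone.exists_clopens {F : KHFrame.{u}} (hF : F.IsStone) {x : F.carrier}
    {K : Set F.carrier} (hK : IsClosed K) (hx : x ∉ K) :
    ∃ U : Clopens F.carrier, x ∉ U ∧ ∀ y ∈ K, y ∈ U := by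
  obtain ⟨V, hV, hxV, hVK⟩ := TopologicalSpace.IsTopologicalBasis.exists_subset_of_mem_open hF
    (show x ∈ Kᶜ from hx) hK.isOpen_compl
  exact ⟨⟨Vᶜ, IsClopen.compl hV⟩, fun h => h hxV, fun y hy hyV => hVK hyV hy⟩

theorem clopenFunctor_map_injective (F : KHFrame.{u}) {G : KHFrame.{u}} (hG : G.IsStone) :
    Function.Injective (clopenFunctor.map : (F ⟶ G) → _) := by
  intro f g h
  have h' : Hom.toModalAlgHom f = Hom.toModalAlgHom g :=
    congrArg (fun t : Opposite.op F.clopenAlg ⟶ Opposite.op G.clopenAlg => t.unop) h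
  apply Hom.ext
  funext x
  by_contra hne
  obtain ⟨U, hU, hU'⟩ := hG.exists_clopens (x := f.toFun x) (K := {g.toFun x})
    isClosed_singleton hne
  have h0 : f.toFun ⁻¹' U = g.toFun ⁻¹' U :=
    congrArg (fun t : ModalAlg.Hom G.clopenAlg F.clopenAlg =>
      ((id (t.toFun U) : Clopens F.carrier) : Set F.carrier)) h'
  exact hU ((Set.ext_iff.1 h0 x).2 (hU' _ rfl))

/-- The clopens `U` with `x ∈ φ U` are nonempty and closed under intersection, so by compactness
they share a point; complements turn the resulting implication into an equivalence. -/
theorem exists_continuousMap_of_boundedLatticeHom {X Y : Type u} [TopologicalSpace X]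
    [TopologicalSpace Y] [CompactSpace Y]
    (hY : TopologicalSpace.IsTopologicalBasis {U : Set Y | IsClopen U})
    (φ : BoundedLatticeHom (Clopens Y) (Clopens X)) :
    ∃ g : C(X, Y), ∀ (U : Clopens Y) (x : X), x ∈ φ U ↔ g x ∈ U := by
  have key (x : X) : ∃ y : Y, ∀ U : Clopens Y, x ∈ φ U → y ∈ U := by
    let ι := {U : Clopens Y // x ∈ φ U}
    have : Nonempty ι := ⟨⟨⊤, by rw [map_top]; trivial⟩⟩
    obtain ⟨y, hy⟩ := IsCompact.nonempty_iInter_of_directed_nonempty_isCompact_isClosed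
      (fun i : ι => (i.1 : Set Y))
      (fun U V => ⟨⟨U.1 ⊓ V.1, by rw [map_inf]; exact ⟨U.2, V.2⟩⟩,
        fun _ h => h.1, fun _ h => h.2⟩)
      (by
        rintro ⟨U, hU⟩
        by_contra hn
        have : U = ⊥ := SetLike.coe_injective (Set.not_nonempty_iff_eq_empty.1 hn)
        rw [this, map_bot] at hU
        exact hU)
      (fun U => U.1.isClopen.isClosed.isCompact) (fun U => U.1.isClopen.isClosed)
    rw [Set.mem_iInter] at hy
    exact ⟨y, fun U hU => hy ⟨U, hU⟩⟩
  choose g hg using key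
  have hiff (U : Clopens Y) (x : X) : x ∈ φ U ↔ g x ∈ U := by
    refine ⟨hg x U, fun h => ?_⟩
    by_contra hn
    refine hg x Uᶜ ?_ h
    rw [map_compl']
    exact hn
  refine ⟨⟨g, hY.continuous_iff.2 fun U hU => ?_⟩, hiff⟩
  have : g ⁻¹' U = φ ⟨U, hU⟩ := by
    ext x
    exact (hiff ⟨U, hU⟩ x).symm
  rw [this]
  exact (φ ⟨U, hU⟩).isClopen.isOpen

theorem clopenFunctor_map_surjective (F : KHFrame.{u}) {G : KHFrame.{u}} (hG : G.IsStone) :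
    Function.Surjective (clopenFunctor.map : (F ⟶ G) → _) := by
  intro φ'
  obtain ⟨φ, rfl⟩ : ∃ φ : G.clopenAlg ⟶ F.clopenAlg, φ' = φ.op := ⟨φ'.unop, rfl⟩
  obtain ⟨g, hg⟩ := exists_continuousMap_of_boundedLatticeHom (X := F.carrier) (Y := G.carrier)
    hG φ.toBoundedLatticeHom
  have hbox (U : Clopens G.carrier) (x : F.carrier) :
      (∀ z, G.rel (g x) z → z ∈ U) ↔ ∀ y, F.rel x y → g y ∈ U := by
    have h1 : φ.toBoundedLatticeHom (G.clopenBox U) = F.clopenBox (φ.toBoundedLatticeHom U) :=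
      φ.map_box' U
    have h2 := SetLike.ext_iff (p := (_ : Clopens F.carrier)) (q := (_ : Clopens F.carrier)).1 h1 x
    exact (hg (G.clopenBox U) x).symm.trans <| h2.trans (forall_congr' fun y => imp_congr_right fun _ => hg U y)
  refine ⟨(⟨g, fun x => Set.Subset.antisymm ?_ ?_⟩ : Hom F G), ?_⟩
  · rintro _ ⟨y, hy, rfl⟩
    by_contra hn
    obtain ⟨U, hU, hU'⟩ := hG.exists_clopens (G.isContinuousRel.isClosed_image (g x)) hn
    exact hU ((hbox U x).1 hU' y hy)
  · intro z hz
    by_contra hn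
    obtain ⟨U, hU, hU'⟩ := hG.exists_clopens
      (((F.isContinuousRel.isClosed_image x).isCompact.image g.continuous).isClosed) hn
    exact hU ((hbox U x).2 (fun y hy => hU' _ ⟨y, hy, rfl⟩) z hz)
  · refine congrArg (Quiver.Hom.op (X := G.clopenAlg) (Y := F.clopenAlg)) ?_
    apply ModalAlg.Hom.ext
    funext U
    exact SetLike.ext (p := (_ : Clopens F.carrier)) (q := (_ : Clopens F.carrier))
      fun x => (hg U x).symm

section Sat

variable {F : KHFrame.{u}} (hF : F.IsStone)

theorem satD_clopenAlg_iff : F.clopenAlg.SatD ↔ F.SatD := by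
  have h1 : F.clopenAlg.SatD ↔ ∀ x : F.carrier, x ∈ F.clopenBox ⊥ ↔ x ∈ (⊥ : Clopens F.carrier) :=
    SetLike.ext_iff (p := F.clopenBox ⊥) (q := (⊥ : Clopens F.carrier))
  rw [h1]
  refine forall_congr' fun x => ⟨fun h => ?_, fun ⟨y, hy⟩ => ⟨fun h => h y hy, fun h => h.elim⟩⟩
  by_contra! hn
  exact h.1 fun y hy => (hn y hy).elim

include hF

theorem satT_clopenAlg_iff : F.clopenAlg.SatT ↔ F.SatT := by
  constructor
  · intro h x
    by_contra hx
    obtain ⟨U, hU, hU'⟩ := hF.exists_clopens (F.isContinuousRel.isClosed_image x) hx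
    exact hU (h U (show x ∈ F.clopenBox U from hU'))
  · exact fun h U x hx => hx x (h x)

theorem satK4_clopenAlg_iff : F.clopenAlg.SatK4 ↔ F.SatK4 := by
  constructor
  · intro h x y z hxy hyz
    by_contra hx
    obtain ⟨U, hU, hU'⟩ := hF.exists_clopens (F.isContinuousRel.isClosed_image x) hx
    exact hU (h U (show x ∈ F.clopenBox U from hU') y hxy z hyz)
  · exact fun h U x hx y hy z hz => hx z (h x y z hy hz)

theorem satB_clopenAlg_iff : F.clopenAlg.SatB ↔ F.SatB := by
  constructor
  · intro h x y hxy
    by_contra hyx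
    obtain ⟨U, hU, hU'⟩ := hF.exists_clopens (F.isContinuousRel.isClosed_image y) hyx
    exact hU (h U (show x ∈ (F.clopenBox (F.clopenBox U)ᶜ)ᶜ from fun hx => hx y hxy hU'))
  · intro h U x hx
    by_contra hn
    exact hx fun y hy hy' => hn (hy' x (h x y hy))

theorem sat_clopenAlg_iff (L : ModalLogic) : ModalAlg.Sat L F.clopenAlg ↔ KHFrame.Sat L F := by
  cases L
  · exact satD_clopenAlg_iff
  · exact satT_clopenAlg_iff hF
  · exact satK4_clopenAlg_iff hF
  · exact satB_clopenAlg_iff hF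
  · exact and_congr (satT_clopenAlg_iff hF) (satK4_clopenAlg_iff hF)
  · exact and_congr (and_congr (satT_clopenAlg_iff hF) (satK4_clopenAlg_iff hF))
      (satB_clopenAlg_iff hF)

end Sat

end KHFrame

/-! ### Transport of modal axioms -/

namespace ModalAlg.Hom

variable {A B : ModalAlg.{u}} (f : Hom A B)

theorem map_box (a : A.carrier) :
    f.toBoundedLatticeHom (A.box a) = B.box (f.toBoundedLatticeHom a) := f.map_box' a

theorem map_dia (a : A.carrier) :
    f.toBoundedLatticeHom (A.dia a) = B.dia (f.toBoundedLatticeHom a) := by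
  simp only [dia, map_compl', map_box]

theorem satD {A B : ModalAlg.{u}} (f : Hom A B) (h : A.SatD) : B.SatD := by
  have h1 := f.map_box ⊥
  rw [show A.box ⊥ = ⊥ from h, map_bot] at h1
  exact h1.symm

theorem satT (hf : Function.Surjective f.toBoundedLatticeHom) (h : A.SatT) : B.SatT := by
  intro b
  obtain ⟨a, rfl⟩ := hf b
  rw [← map_box]
  exact OrderHomClass.mono f.toBoundedLatticeHom (h a)

theorem satK4 (hf : Function.Surjective f.toBoundedLatticeHom) (h : A.SatK4) : B.SatK4 := by
  intro b
  obtain ⟨a, rfl⟩ := hf b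
  rw [← map_box, ← map_box]
  exact OrderHomClass.mono f.toBoundedLatticeHom (h a)

theorem satB (hf : Function.Surjective f.toBoundedLatticeHom) (h : A.SatB) : B.SatB := by
  intro b
  obtain ⟨a, rfl⟩ := hf b
  rw [← map_box, ← map_dia]
  exact OrderHomClass.mono f.toBoundedLatticeHom (h a)

theorem sat (hf : Function.Surjective f.toBoundedLatticeHom) (L : ModalLogic)
    (h : ModalAlg.Sat L A) : ModalAlg.Sat L B := by
  cases L
  · exact f.satD h
  · exact f.satT hf h
  · exact f.satK4 hf h
  · exact f.satB hf h
  · exact ⟨f.satT hf h.1, f.satK4 hf h.2⟩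
  · exact ⟨⟨f.satT hf h.1.1, f.satK4 hf h.1.2⟩, f.satB hf h.2⟩

/-- A bijective homomorphism is an isomorphism. -/
noncomputable def isoOfBijective (hf : Function.Bijective f.toBoundedLatticeHom) : A ≅ B :=
  let e := Equiv.ofBijective f.toBoundedLatticeHom hf
  have he (b : B.carrier) : f.toBoundedLatticeHom (e.symm b) = b := e.apply_symm_apply b
  { hom := f
    inv :=
      { toFun := e.symm
        map_sup' := fun a b => hf.1 ((he _).trans
          ((congrArg₂ _ (he a) (he b)).symm.trans (map_sup f.toBoundedLatticeHom _ _).symm))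
        map_inf' := fun a b => hf.1 ((he _).trans
          ((congrArg₂ _ (he a) (he b)).symm.trans (map_inf f.toBoundedLatticeHom _ _).symm))
        map_top' := hf.1 (by rw [he, map_top])
        map_bot' := hf.1 (by rw [he, map_bot])
        map_box' := fun a => hf.1 (by
          rw [map_box]
          exact (he _).trans (congrArg B.box (he a).symm)) }
    hom_inv_id := Hom.ext (funext fun a => e.symm_apply_apply a)
    inv_hom_id := Hom.ext (funext fun a => e.apply_symm_apply a) }

end ModalAlg.Hom

/-! ### The Stone space of a boolean algebra -/

/-- Homomorphisms to the two-element boolean algebra. -/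
def StoneSpace (B : Type u) [BooleanAlgebra B] : Type u := BoundedLatticeHom B Bool

namespace StoneSpace

variable {B : Type u} [BooleanAlgebra B]

instance : FunLike (StoneSpace B) B Bool := inferInstanceAs (FunLike (BoundedLatticeHom B Bool) B Bool)

instance : BoundedLatticeHomClass (StoneSpace B) B Bool :=
  inferInstanceAs (BoundedLatticeHomClass (BoundedLatticeHom B Bool) B Bool)

instance : TopologicalSpace (StoneSpace B) :=
  TopologicalSpace.induced (fun x a => x a) inferInstance

theorem isInducing_coe : Topology.IsInducing (fun (x : StoneSpace B) (a : B) => x a) := ⟨rfl⟩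

theorem continuous_eval (a : B) : Continuous fun x : StoneSpace B => x a :=
  (continuous_apply a).comp isInducing_coe.continuous

theorem isClopen_eval_eq (a : B) (t : Bool) : IsClopen {x : StoneSpace B | x a = t} :=
  (isClopen_discrete {t}).preimage (continuous_eval a)

instance : T2Space (StoneSpace B) :=
  T2Space.of_injective_continuous (f := fun (x : StoneSpace B) (a : B) => x a)
    DFunLike.coe_injective isInducing_coe.continuous

theorem isClosed_range_coe : IsClosed (Set.range fun (x : StoneSpace B) (a : B) => x a) := by
  have : (Set.range fun (x : StoneSpace B) (a : B) => x a) =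
      {g | g ⊤ = ⊤} ∩ {g | g ⊥ = ⊥} ∩ (⋂ a, ⋂ b, {g : B → Bool | g (a ⊔ b) = g a ⊔ g b}) ∩
      (⋂ a, ⋂ b, {g : B → Bool | g (a ⊓ b) = g a ⊓ g b}) := by
    ext g
    simp only [Set.mem_range, Set.mem_inter_iff, Set.mem_iInter, Set.mem_ofPred_eq]
    constructor
    · rintro ⟨x, rfl⟩
      exact ⟨⟨⟨map_top x, map_bot x⟩, map_sup x⟩, map_inf x⟩
    · rintro ⟨⟨⟨h1, h2⟩, h3⟩, h4⟩
      exact ⟨(⟨⟨⟨g, h3⟩, h4⟩, h1, h2⟩ : BoundedLatticeHom B Bool), rfl⟩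
  rw [this]
  refine IsClosed.inter (IsClosed.inter (IsClosed.inter ?_ ?_) ?_) ?_
  · exact isClosed_eq (continuous_apply _) continuous_const
  · exact isClosed_eq (continuous_apply _) continuous_const
  · exact isClosed_iInter fun a => isClosed_iInter fun b => isClosed_eq (continuous_apply _)
      (Continuous.comp (g := fun p : Bool × Bool => p.1 ⊔ p.2) (f := fun g : B → Bool => (g a, g b))
        continuous_of_discreteTopology ((continuous_apply a).prodMk (continuous_apply b)))
  · exact isClosed_iInter fun a => isClosed_iInter fun b => isClosed_eq (continuous_apply _)
      (Continuous.comp (g := fun p : Bool × Bool => p.1 ⊓ p.2) (f := fun g : B → Bool => (g a, g b))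
        continuous_of_discreteTopology ((continuous_apply a).prodMk (continuous_apply b)))

instance : CompactSpace (StoneSpace B) := by
  rw [← isCompact_univ_iff, isInducing_coe.isCompact_iff, Set.image_univ]
  exact isClosed_range_coe.isCompact

/-- A basic open set restricts finitely many coordinates, and the meet of the literals `i` or `iᶜ`
true at `x` fixes these coordinates. -/
theorem exists_eval_subset {U : Set (StoneSpace B)} (hU : IsOpen U) {x : StoneSpace B}
    (hx : x ∈ U) : ∃ a, x a = true ∧ ∀ y : StoneSpace B, y a = true → y ∈ U := by
  obtain ⟨V, hV, rfl⟩ := isInducing_coe.isOpen_iff.1 hU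
  obtain ⟨I, v, hv, hIV⟩ := isOpen_pi_iff.1 hV _ hx
  classical
  let lit (i : B) : B := if x i = true then i else iᶜ
  have hlit (y : StoneSpace B) (i : B) : y (lit i) = true ↔ y i = x i := by
    by_cases h : x i = true
    · simp [lit, h]
    · rw [Bool.not_eq_true] at h
      simp [lit, h]
  have hinf (y : StoneSpace B) : y (I.inf lit) = true ↔ ∀ i ∈ I, y i = x i := by
    rw [map_finset_inf]
    exact (Finset.inf_eq_top_iff _ _).trans (forall₂_congr fun i _ => hlit y i)
  refine ⟨I.inf lit, (hinf x).2 fun _ _ => rfl, fun y hy => hIV fun i hi => ?_⟩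
  change y i ∈ v i
  rw [(hinf y).1 hy i hi]
  exact (hv i hi).2

theorem exists_eval_eq_of_isClopen {U : Set (StoneSpace B)} (hU : IsClopen U) :
    ∃ a, {x : StoneSpace B | x a = true} = U := by
  obtain ⟨a, h1, h2⟩ := hU.isClosed.isCompact.induction_on
    (p := fun s => ∃ a, s ⊆ {x : StoneSpace B | x a = true} ∧ {x : StoneSpace B | x a = true} ⊆ U)
    ⟨⊥, Set.empty_subset _, fun x (hx : x ⊥ = true) => by simp at hx⟩
    (fun s t hst ⟨a, h1, h2⟩ => ⟨a, hst.trans h1, h2⟩)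
    (fun s t ⟨a, h1, h2⟩ ⟨b, h3, h4⟩ => by
      have hab : {x : StoneSpace B | x (a ⊔ b) = true} =
          {x : StoneSpace B | x a = true} ∪ {x : StoneSpace B | x b = true} := by
        ext x
        simp
      exact ⟨a ⊔ b, hab ▸ Set.union_subset_union h1 h3, hab ▸ Set.union_subset h2 h4⟩)
    (fun x hx => by
      obtain ⟨a, ha, hU⟩ := exists_eval_subset hU.isOpen hx
      exact ⟨_, mem_nhdsWithin_of_mem_nhds ((isClopen_eval_eq a true).isOpen.mem_nhds ha),
        a, subset_rfl, hU⟩)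
  exact ⟨a, h2.antisymm h1⟩

theorem isTopologicalBasis_isClopen :
    TopologicalSpace.IsTopologicalBasis {U : Set (StoneSpace B) | IsClopen U} := by
  refine TopologicalSpace.isTopologicalBasis_of_isOpen_of_nhds (fun U hU => hU.isOpen) ?_
  intro x U hx hU
  obtain ⟨a, ha, h⟩ := exists_eval_subset hU hx
  exact ⟨_, isClopen_eval_eq a true, ha, h⟩

/-- The prime ideal theorem gives a prime ideal containing `a` and disjoint from the filter; the
indicator of its complement is the homomorphism. -/
theorem exists_separating (F : Order.PFilter B) {a : B} (ha : a ∉ F) :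
    ∃ x : StoneSpace B, (∀ b ∈ F, x b = true) ∧ x a = false := by
  obtain ⟨J, hJ, haJ, hFJ⟩ := DistribLattice.prime_ideal_of_disjoint_filter_ideal
    (F := F) (I := Order.Ideal.principal a)
    (Set.disjoint_left.2 fun b hb hba => ha (Order.PFilter.mem_of_le hba hb))
  classical
  refine ⟨({ toFun := fun b => decide (b ∉ J)
             map_sup' := fun b c => ?_
             map_inf' := fun b c => ?_
             map_top' := ?_
             map_bot' := ?_ } : BoundedLatticeHom B Bool), fun b hb => ?_, ?_⟩
  · rw [Bool.eq_iff_iff]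
    simp [Order.Ideal.sup_mem_iff, imp_iff_not_or]
  · have : b ⊓ c ∈ J ↔ b ∈ J ∨ c ∈ J :=
      ⟨hJ.mem_or_mem, fun h => h.elim (J.lower inf_le_left) (J.lower inf_le_right)⟩
    rw [Bool.eq_iff_iff]
    simp [this]
  · exact decide_eq_true hJ.1.top_notMem
  · exact decide_eq_false (not_not.2 J.bot_mem)
  · exact decide_eq_true fun hbJ => Set.disjoint_left.1 hFJ hb hbJ
  · exact decide_eq_false (not_not.2 (haJ (Order.Ideal.mem_principal_self)))

end StoneSpace

/-! ### The frame of a modal algebra -/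

namespace ModalAlg

variable (A : ModalAlg.{u})

/-- The relation on the Stone space. -/
def stoneRel (x y : StoneSpace A.carrier) : Prop := ∀ a, x (A.box a) = true → y a = true

variable {A}

theorem box_mono {a b : A.carrier} (h : a ≤ b) : A.box a ≤ A.box b := by
  have := A.box_inf a b
  rw [inf_eq_left.2 h] at this
  exact inf_eq_left.1 this.symm

/-- The `b` with `x(□b)` true form a filter that omits `a`; any homomorphism separating the two is a
successor of `x`. -/
theorem exists_stoneRel {x : StoneSpace A.carrier} {a : A.carrier} (h : x (A.box a) = false) :
    ∃ y, A.stoneRel x y ∧ y a = false := by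
  have hF : Order.IsPFilter {b : A.carrier | x (A.box b) = true} := by
    refine Order.IsPFilter.of_def ⟨⊤, ?_⟩ ?_ ?_
    · rw [Set.mem_ofPred_eq, A.box_top]
      exact map_top x
    · intro b (hb : x (A.box b) = true) c (hc : x (A.box c) = true)
      refine ⟨b ⊓ c, ?_, inf_le_left, inf_le_right⟩
      rw [Set.mem_ofPred_eq, A.box_inf, map_inf, hb, hc]
      rfl
    · intro b c hbc (hb : x (A.box b) = true)
      have := OrderHomClass.mono x (box_mono hbc)
      rw [hb] at this
      exact top_le_iff.1 this
  obtain ⟨y, hy, hya⟩ := StoneSpace.exists_separating hF.toPFilter (a := a)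
    (fun h' : x (A.box a) = true => by rw [h] at h'; exact Bool.false_ne_true h')
  exact ⟨y, fun b hb => hy b hb, hya⟩

theorem isContinuousRel_stoneRel : IsContinuousRel A.stoneRel := by
  refine ⟨fun x => ?_, fun F hF => ?_, fun U hU => ?_⟩
  · simp only [stoneRel, Set.ofPred_forall]
    exact isClosed_iInter fun a => isClosed_iInter fun _ =>
      (StoneSpace.isClopen_eval_eq a true).isClosed
  · have hG : IsClosed {p : StoneSpace A.carrier × StoneSpace A.carrier |
        p.2 ∈ F ∧ A.stoneRel p.1 p.2} := by
      refine (hF.preimage continuous_snd).inter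
        (s₂ := {p : StoneSpace A.carrier × StoneSpace A.carrier | A.stoneRel p.1 p.2}) ?_
      simp only [stoneRel, Set.ofPred_forall]
      exact isClosed_iInter fun a =>
        (isClosed_discrete {q : Bool × Bool | q.1 = true → q.2 = true}).preimage
          (((StoneSpace.continuous_eval (A.box a)).comp continuous_fst).prodMk
            ((StoneSpace.continuous_eval a).comp continuous_snd))
    convert isClosedMap_fst_of_compactSpace _ hG using 1
    ext x
    simp
  · rw [isOpen_iff_mem_nhds]
    rintro x ⟨y, hyU, hxy⟩
    obtain ⟨a, ha, haU⟩ := StoneSpace.exists_eval_subset hU hyU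
    -- Falsity of `□aᶜ` is a clopen condition, and at any `z` satisfying it there is a successor
    -- where `a` is true.
    have hx : x (A.box aᶜ) = false := by
      rw [← Bool.not_eq_true]
      intro h
      have := hxy _ h
      rw [map_compl', ha] at this
      exact Bool.false_ne_true this
    filter_upwards [(StoneSpace.isClopen_eval_eq (A.box aᶜ) false).isOpen.mem_nhds hx] with z hz
    obtain ⟨w, hw, hwa⟩ := exists_stoneRel hz
    refine ⟨w, haU w ?_, hw⟩
    simpa [map_compl'] using hwa

variable (A) in
/-- The descriptive frame of a modal algebra. -/
def stone : KHFrame.{u} where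
  carrier := StoneSpace A.carrier
  rel := A.stoneRel
  isContinuousRel := isContinuousRel_stoneRel

variable (A) in
/-- The Stone representation of a modal algebra. -/
def stoneHom : Hom A A.stone.clopenAlg where
  toFun a := (⟨{x : StoneSpace A.carrier | x a = true}, StoneSpace.isClopen_eval_eq a true⟩ :
    TopologicalSpace.Clopens (StoneSpace A.carrier))
  map_sup' a b := TopologicalSpace.Clopens.ext (α := StoneSpace A.carrier) (by
    ext x
    change x (a ⊔ b) = true ↔ x a = true ∨ x b = true
    simp)
  map_inf' a b := TopologicalSpace.Clopens.ext (α := StoneSpace A.carrier) (by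
    ext x
    change x (a ⊓ b) = true ↔ x a = true ∧ x b = true
    simp)
  map_top' := TopologicalSpace.Clopens.ext (α := StoneSpace A.carrier) (by
    ext x
    change x ⊤ = true ↔ True
    simp)
  map_bot' := TopologicalSpace.Clopens.ext (α := StoneSpace A.carrier) (by
    ext x
    change x ⊥ = true ↔ False
    simp)
  map_box' a := TopologicalSpace.Clopens.ext (α := StoneSpace A.carrier) (by
    ext x
    change x (A.box a) = true ↔ ∀ y, A.stoneRel x y → y a = true
    refine ⟨fun h y hy => hy a h, fun h => ?_⟩
    by_contra hn
    obtain ⟨y, hy, hya⟩ := exists_stoneRel (Bool.eq_false_of_not_eq_true hn)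
    rw [h y hy] at hya
    exact Bool.false_ne_true hya.symm)

theorem stoneHom_bijective : Function.Bijective A.stoneHom.toBoundedLatticeHom := by
  constructor
  · have hle {a b : A.carrier}
        (h : ∀ x : StoneSpace A.carrier, x a = true → x b = true) : a ≤ b := by
      by_contra hn
      obtain ⟨x, hx, hxb⟩ := StoneSpace.exists_separating (Order.PFilter.principal a) (a := b)
        (fun h => hn (Order.PFilter.mem_principal.1 h))
      rw [h x (hx a (Order.PFilter.mem_principal.2 le_rfl))] at hxb
      exact Bool.false_ne_true hxb.symm
    intro a b hab
    have hx (x : StoneSpace A.carrier) : x a = true ↔ x b = true :=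
      SetLike.ext_iff (p := (_ : TopologicalSpace.Clopens (StoneSpace A.carrier)))
        (q := (_ : TopologicalSpace.Clopens (StoneSpace A.carrier))).1 hab x
    exact le_antisymm (hle fun x => (hx x).1) (hle fun x => (hx x).2)
  · intro (U : TopologicalSpace.Clopens (StoneSpace A.carrier))
    obtain ⟨a, ha⟩ := StoneSpace.exists_eval_eq_of_isClopen U.isClopen
    exact ⟨a, TopologicalSpace.Clopens.ext (α := StoneSpace A.carrier) ha⟩

end ModalAlg

theorem nonempty_maCat_op_equivalence (L : ModalLogic) :
    Nonempty ((MACat.{u} L)ᵒᵖ ≌ DFCat.{u} L) := by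
  refine nonempty_dualEquivalence KHFrame.clopenFunctor _ _ ?_ ?_ ?_ ?_
  · exact fun F hF => (KHFrame.sat_clopenAlg_iff hF.1 L).2 hF.2
  · exact fun F G _ hG => KHFrame.clopenFunctor_map_injective F hG.1
  · exact fun F G _ hG => KHFrame.clopenFunctor_map_surjective F hG.1
  · intro A hL
    have hS : A.stone.IsStone := StoneSpace.isTopologicalBasis_isClopen
    exact ⟨A.stone, ⟨hS, (KHFrame.sat_clopenAlg_iff hS L).1
      (A.stoneHom.sat ModalAlg.stoneHom_bijective.2 L hL)⟩,
      ⟨(A.stoneHom.isoOfBijective ModalAlg.stoneHom_bijective).symm⟩⟩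

theorem mainTheorem7 (L : ModalLogic) :
    Nonempty ((MubalCat.{u} L)ᵒᵖ ≌ KHFCat.{u} L) ∧
    Nonempty ((McubalCat.{u} L)ᵒᵖ ≌ DFCat.{u} L) ∧
    Nonempty ((MACat.{u} L)ᵒᵖ ≌ DFCat.{u} L) ∧
    Nonempty (McubalCat.{u} L ≌ MACat.{u} L) := by
  obtain ⟨e⟩ := nonempty_mcubalCat_op_equivalence.{u} L
  obtain ⟨e'⟩ := nonempty_maCat_op_equivalence.{u} L
  exact ⟨nonempty_mubalCat_op_equivalence L, ⟨e⟩, ⟨e'⟩, ⟨(e.trans e'.symm).unop⟩⟩
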